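/- For $z$ in the upper half-plane $\mathbb H$ write $q=e^{2\pi i z}$ (and $q^{a}=e^{2\pi i a z}$), and put $$\Theta_2(z)=q^{1/8}\sum_{n\in\mathbb Z}q^{n(n+1)/2},\qquad \Theta_3(z)=\sum_{n\in\mathbb Z}q^{n^2/2}.$$ Let $e_n$ be the Euler numbers, $\sec t=\sum_{n\ge 0}\frac{e_n}{n!}t^n$, let $\chi(d)=\left(\frac{-1}{d}\right)$ for odd $d$, and for $k\ge 0$ let $$E_{2k+1,\chi}(z)=\frac12\sum_{\substack{(c,d)\equiv(0,1)\ (\mathrm{mod}\ 2)\\ \gcd(c,d)=1}}\chi(d)(cz+d)^{-(2k+1)},\qquad G_{2k+1}(z)=z^{-(2k+1)}E_{2k+1,\chi}\!\left(\frac{z-1}{z}\right),$$ so that $G_{2k+1}=E_{2k+1,\chi}|_{2k+1}\gamma_0$ with $\gamma_0=\begin{pmatrix}1&-1\\1&0\end{pmatrix}$. For $k=0$, where the series does not converge absolutely, $E_{1,\chi}(z)$ is the Hecke-regularized sum, i.e. the value at $s=0$ of the analytic continuation of $\frac12\sum\chi(d)(cz+d)^{-1}|cz+d|^{-2s}$ (same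 index set) from $\mathrm{Re}\,s>\frac12$ to a neighbourhood of $\mathrm{Re}\,s\ge 0$. Fix $z\in\mathbb H$, put $$\kappa=\frac{\Theta_2^2(2z)}{\Theta_3^2(2z)},\qquad K=\frac{\pi}{2}\,\Theta_3^2(2z),$$ and let $\mathrm{cn}(u)$ be the Jacobi elliptic function of modulus $\kappa$ and quarter period $K$, i.e. with $\tau=2z$ $$\mathrm{cn}(u)=\frac{\theta_4(0|\tau)}{\theta_2(0|\tau)}\cdot\frac{\theta_2(x|\tau)}{\theta_4(x|\tau)},\quad x=\frac{\pi u}{2K},\qquad \theta_2(x|\tau)=\sum_{n\in\mathbb Z}e^{\pi i(n+1/2)^2\tau}e^{(2n+1)ix},\quad \theta_4(x|\tau)=\sum_{n\in\mathbb Z}(-1)^ne^{\pi i n^2\tau}e^{2nix}.$$ **Proposition.** The function $\mathrm{cn}$ is analytic at $u=0$, and $$\mathrm{cn}(u)=\sum_{k=0}^{\infty}\frac{i\,e_{2k}\,\pi^{2k+1}}{2^{2k+1}(2k)!}\cdot\frac{G_{2k+1}(2z)}{K^{2k+1}\kappa}\,u^{2k},$$ where the series converges to $\mathrm{cn}(u)$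 for every $u$ in every disc $|u|<r$ on which $\mathrm{cn}$ has no pole. In this sense $\mathrm{cn}(u)$ is a generating function of the $G_{2k+1}(2z)$. -/

import Mathlib

open Complex
open UpperHalfPlane hiding I
open scoped Real Topology MatrixGroups ModularForm

noncomputable section

namespace JacobiEisenstein

/-! ### Theta functions -/

/-- The theta constant `Θ₂(z) = q^{1/8} ∑_{n ∈ ℤ} q^{n(n+1)/2}`, where `q ^ a = exp (2πi a z)`. -/
def Theta2 (z : ℍ) : ℂ :=
  cexp (2 * π * I * z * (1 / 8)) * ∑' n : ℤ, cexp (2 * π * I * z * ((n : ℂ) * (n + 1) / 2))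

/-- The theta constant `Θ₃(z) = ∑_{n ∈ ℤ} q^{n²/2}`, where `q ^ a = exp (2πi a z)`. -/
def Theta3 (z : ℍ) : ℂ :=
  ∑' n : ℤ, cexp (2 * π * I * z * ((n : ℂ) ^ 2 / 2))

/-- Jacobi's theta function
`θ₂(x | τ) = ∑_{n ∈ ℤ} exp (πi (n + 1/2)² τ) exp ((2n + 1) i x)`. -/
def jacobiThetaTwo (x : ℂ) (τ : ℍ) : ℂ :=
  cexp (π * I * τ / 4 + I * x) * jacobiTheta₂ (x / π + τ / 2) τ

/-- Jacobi's theta function `θ₄(x | τ) = ∑_{n ∈ ℤ} (-1)ⁿ exp (πi n² τ) exp (2 n i x)`. -/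
def jacobiThetaFour (x : ℂ) (τ : ℍ) : ℂ :=
  jacobiTheta₂ (x / π + 1 / 2) τ

theorem jacobiThetaTwo_eq_tsum (x : ℂ) (τ : ℍ) :
    jacobiThetaTwo x τ =
      ∑' n : ℤ, cexp (π * I * ((n : ℂ) + 1 / 2) ^ 2 * τ) * cexp ((2 * (n : ℂ) + 1) * I * x) := by
  have hpi : (π : ℂ) ≠ 0 := by exact_mod_cast Real.pi_ne_zero
  rw [jacobiThetaTwo, jacobiTheta₂, ← tsum_mul_left]
  refine tsum_congr fun n => ?_
  rw [jacobiTheta₂_term, ← Complex.exp_add, ← Complex.exp_add]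
  congr 1
  field_simp
  ring

theorem jacobiThetaFour_eq_tsum (x : ℂ) (τ : ℍ) :
    jacobiThetaFour x τ =
      ∑' n : ℤ, (-1 : ℂ) ^ n * cexp (π * I * (n : ℂ) ^ 2 * τ) * cexp (2 * (n : ℂ) * I * x) := by
  have hpi : (π : ℂ) ≠ 0 := by exact_mod_cast Real.pi_ne_zero
  rw [jacobiThetaFour, jacobiTheta₂]
  refine tsum_congr fun n => ?_
  rw [jacobiTheta₂_term, ← Complex.exp_pi_mul_I, ← Complex.exp_int_mul, ← Complex.exp_add,
    ← Complex.exp_add]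
  congr 1
  field_simp
  ring

theorem jacobiThetaTwo_zero (τ : ℍ) : jacobiThetaTwo 0 τ = Theta2 τ := by
  rw [jacobiThetaTwo_eq_tsum, Theta2, ← tsum_mul_left]
  refine tsum_congr fun n => ?_
  rw [← Complex.exp_add, ← Complex.exp_add]
  congr 1
  ring

/-! ### The Jacobi elliptic function -/

/-- The quarter period `K = (π/2) Θ₃²` of the Jacobi elliptic functions with parameter `τ`, that is,
with nome `exp (πi τ)` and modulus `κ = Θ₂² / Θ₃²`. -/
def quarterPeriod (τ : ℍ) : ℂ := π / 2 * Theta3 τ ^ 2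

/-- The Jacobi elliptic function `cn(u)` of modulus `κ = Θ₂(τ)² / Θ₃(τ)²`, by the classical
theta quotient `cn(u) = (θ₄(0) / θ₂(0)) * (θ₂(x) / θ₄(x))`, with `x = π u / (2 K)`.
It is meromorphic in `u`; the value Lean gives it at a pole is `0`. -/
def jacobiCn (τ : ℍ) (u : ℂ) : ℂ :=
  jacobiThetaFour 0 τ / jacobiThetaTwo 0 τ *
    (jacobiThetaTwo (π * u / (2 * quarterPeriod τ)) τ /
      jacobiThetaFour (π * u / (2 * quarterPeriod τ)) τ)

/-! ### Euler numbers -/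

/-- The Euler number `e_n`, defined by `sec t = ∑ e_n tⁿ / n!`. -/
def eulerNumber (n : ℕ) : ℚ :=
  (n.factorial : ℚ) * PowerSeries.coeff n (PowerSeries.cos ℚ)⁻¹

/-! ### Odd weight Eisenstein series of level 2 -/

/-- The pairs `(c, d)` of coprime integers with `(c, d) ≡ (0, 1)` modulo `2`. -/
def eisIndex : Set (ℤ × ℤ) := {p | Even p.1 ∧ Odd p.2 ∧ IsCoprime p.1 p.2}

/-- `½ ∑ χ(d) (c z + d)^{-m} |c z + d|^{-2s}` over the pairs `(c, d)` in `eisIndex`, where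
`χ(d) = (-1/d)`; the sum converges absolutely for `Re s > 1 - m/2`. -/
def heckeSum (m : ℕ) (z : ℍ) (s : ℂ) : ℂ :=
  1 / 2 * ∑' p : eisIndex, (ZMod.χ₄ (p.1.2 : ZMod 4) : ℂ) *
    (((p.1.1 : ℂ) * z + p.1.2) ^ m)⁻¹ * ((‖(p.1.1 : ℂ) * z + p.1.2‖ : ℝ) : ℂ) ^ (-2 * s)

/-- `w` is the value at `s = 0` of the analytic continuation, to a neighbourhood of the closed
half-plane `Re s ≥ 0`, of the function `S` given on the half-plane `Re s > 1/2`. -/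
def IsHeckeValue (S : ℂ → ℂ) (w : ℂ) : Prop :=
  ∃ F : ℂ → ℂ, AnalyticOnNhd ℂ F {s : ℂ | 0 ≤ s.re} ∧
    (∀ s : ℂ, 1 / 2 < s.re → F s = S s) ∧ F 0 = w

theorem IsHeckeValue.unique {S : ℂ → ℂ} {v w : ℂ} (hv : IsHeckeValue S v)
    (hw : IsHeckeValue S w) : v = w := by
  obtain ⟨F, hF, hFS, rfl⟩ := hv
  obtain ⟨G, hG, hGS, rfl⟩ := hw
  have hconv : IsPreconnected {s : ℂ | 0 ≤ s.re} := (convex_halfSpace_re_ge 0).isPreconnected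
  have hone : (1 : ℂ) ∈ {s : ℂ | 0 ≤ s.re} := by simp
  have hev : F =ᶠ[𝓝 1] G := by
    have hopen : IsOpen {s : ℂ | 1 / 2 < s.re} := isOpen_lt continuous_const Complex.continuous_re
    filter_upwards [hopen.mem_nhds (by norm_num : (1 : ℂ) ∈ {s : ℂ | 1 / 2 < s.re})] with s hs
    rw [hFS s hs, hGS s hs]
  exact hF.eqOn_of_preconnected_of_eventuallyEq hG hconv hone hev (by simp)

/-- The Eisenstein series
`E_{2k+1,χ}(z) = ½ ∑_{(c,d) ≡ (0,1) (2), (c,d) = 1} χ(d) (c z + d)^{-(2k+1)}`.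
The series converges absolutely for `k ≥ 1`; in weight `1` it does not, and there it is understood,
as usual, by Hecke's summation. -/
def eisE (k : ℕ) (z : ℍ) : ℂ :=
  if k = 0 then Classical.epsilon (IsHeckeValue (heckeSum 1 z))
  else 1 / 2 * ∑' p : eisIndex, (ZMod.χ₄ (p.1.2 : ZMod 4) : ℂ) *
    (((p.1.1 : ℂ) * z + p.1.2) ^ (2 * k + 1))⁻¹

/-- The matrix `γ₀ = (1, -1; 1, 0)`. -/
def gammaZero : SL(2, ℤ) := ⟨!![1, -1; 1, 0], by simp [Matrix.det_fin_two_of]⟩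

/-- `G_{2k+1} = E_{2k+1,χ} | γ₀`, the slash operator being of weight `2k+1`. -/
def eisG (k : ℕ) : ℍ → ℂ := eisE k ∣[((2 * k + 1 : ℕ) : ℤ)] gammaZero

/-- The point `2z` of the upper half-plane. -/
def twice (z : ℍ) : ℍ :=
  ⟨2 * (z : ℂ), by simpa using z.im_pos⟩

end JacobiEisenstein

end

/-! Put τ = 2z and v = u/K. The Jacobi triple product (`jacobiTheta₂_eq_prod`) shows that the theta
quotient v ↦ cn(Kv) can have poles only at the points w = (2m+1)τ + 2n, and that at τ the principal
part is simple with residue -2i/(πΘ₂²) = -i/(Kκ). Both v ↦ v+2 and v ↦ v+2τ change the sign of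
cn(Kv), so the residue at w carries the sign (-1)^(m+n). Hence cn(Kv) is the residue at τ times ∑
(-1)^(m+n)/(v-w): the difference extends to an entire function that is antiperiodic in two
directions, hence bounded, hence constant, hence 0 (`cnNormalized_eq_poleSum`).

That series does not converge absolutely. Since the sign flips under w ↦ w+2, replacing each term
φ(w) by (2φ(w) - φ(w-2) - φ(w+2))/4 leaves every absolutely convergent sum unchanged
(`tsum_negSecondDiff`) and gains two powers of |w|. This one regularization serves the partial
fractions, the power sums over the poles, and Hecke's summation in weight one.

Geometric expansion of the partial fractions, averaged over ±v, gives cn(Kv) = -Res · ∑ S_k v^(2k),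
where S_k is the regularized sum of (-1)^(m+n) w^(-(2k+1)) (`hasSum_cnNormalized`). Now write (-2n,
2m+1+2n) = N(c,d) with N the gcd, which is odd. Then w = N((c+d)τ - c) and (-1)^(m+n) = χ(N)χ(d), so
the sum splits as S_k = 2 L(2k+1,χ) G_{2k+1}(τ) (`LFunction_mul_eisG`). For k = 0 the splitting is
made with w⁻¹|w|^(-2s) for Re s > 1/2. The regularized sum is analytic on a neighbourhood of Re s ≥
0, and L(1+2s,χ) has no zero there on Re s ≥ 0, so the identity persists at s = 0.

Finally L(2k+1,χ) = e_{2k} π^(2k+1) / (2^(2k+2) (2k)!) (`LFunction_chiFour_odd`). This gives the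
expansion near 0, and uniqueness of Taylor coefficients carries it to every pole-free disc
(`hasSum_even_of_analyticOnNhd`). -/

noncomputable section

namespace JacobiEisenstein

/-! ### The Jacobi triple product -/

/-- The finite `q`-factorial `∏_{i < n} (1 - Q ^ (i + 1))`. -/
def qFactorial (Q : ℂ) (n : ℕ) : ℂ := ∏ i ∈ Finset.range n, (1 - Q ^ (i + 1))

/-- The inverse of the `q`-factorial, extended by `0` to the negative integers. -/
def invQFactorial (Q : ℂ) (m : ℤ) : ℂ := if 0 ≤ m then (qFactorial Q m.toNat)⁻¹ else 0

lemma one_sub_pow_ne_zero {Q : ℂ} (hQ : ‖Q‖ < 1) (n : ℕ) : 1 - Q ^ (n + 1) ≠ 0 := by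
  intro h
  have h1 : ‖Q ^ (n + 1)‖ = 1 := by rw [← sub_eq_zero.mp h, norm_one]
  rw [norm_pow] at h1
  exact (pow_lt_one₀ (norm_nonneg Q) hQ (Nat.succ_ne_zero n)).ne h1

lemma qFactorial_ne_zero {Q : ℂ} (hQ : ‖Q‖ < 1) (n : ℕ) : qFactorial Q n ≠ 0 :=
  Finset.prod_ne_zero_iff.mpr fun i _ => one_sub_pow_ne_zero hQ i

lemma invQFactorial_natCast (Q : ℂ) (n : ℕ) : invQFactorial Q n = (qFactorial Q n)⁻¹ := by
  simp [invQFactorial]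

/-- With the extension by 0 this recursion has no boundary cases: at m = 0 the factor 1 - Q^0
vanishes, as it should. -/
lemma invQFactorial_sub_one {Q : ℂ} (hQ : ‖Q‖ < 1) (m : ℤ) :
    invQFactorial Q (m - 1) = (1 - Q ^ m) * invQFactorial Q m := by
  rcases lt_trichotomy m 0 with h | rfl | h
  · simp [invQFactorial, show ¬ (0 ≤ m) by lia, show ¬ (1 ≤ m) by lia]
  · simp [invQFactorial]
  · obtain ⟨n, rfl⟩ : ∃ n : ℕ, m = (n + 1 : ℕ) := ⟨(m - 1).toNat, by lia⟩
    rw [show ((n + 1 : ℕ) : ℤ) - 1 = (n : ℤ) by lia, invQFactorial_natCast, invQFactorial_natCast,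
      zpow_natCast]
    have h1 := one_sub_pow_ne_zero hQ n
    have h2 := qFactorial_ne_zero hQ n
    rw [show qFactorial Q (n + 1) = qFactorial Q n * (1 - Q ^ (n + 1)) from
      Finset.prod_range_succ _ _]
    field_simp

/-- The coefficients of the finite triple product. -/
def tripleCoeff (Q : ℂ) (n : ℕ) (k : ℤ) : ℂ :=
  qFactorial Q (2 * n) * (invQFactorial Q (n - k) * invQFactorial Q (n + k))

/-- This compares coefficients of x^k after multiplication by (1 + q^(2n+1) x)(1 + q^(2n+1) x⁻¹).
Everything is expressed through the inverse factorials at a = n+1-k and b = n+1+k, after which the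
claim is a rational identity in Q^a, Q^b and Q. -/
lemma tripleCoeff_succ {q : ℂ} (hq : ‖q‖ < 1) (hq0 : q ≠ 0) (n : ℕ) (k : ℤ) :
    q ^ (k ^ 2) * tripleCoeff (q ^ 2) (n + 1) k =
      (1 + q ^ (4 * n + 2)) * (q ^ (k ^ 2) * tripleCoeff (q ^ 2) n k) +
      q ^ (2 * n + 1) * (q ^ ((k - 1) ^ 2) * tripleCoeff (q ^ 2) n (k - 1)) +
      q ^ (2 * n + 1) * (q ^ ((k + 1) ^ 2) * tripleCoeff (q ^ 2) n (k + 1)) := by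
  have hQ : ‖q ^ 2‖ < 1 := by rw [norm_pow]; exact pow_lt_one₀ (norm_nonneg q) hq two_ne_zero
  have hQ0 : q ^ 2 ≠ 0 := pow_ne_zero 2 hq0
  set Q := q ^ 2 with hQdef
  set a : ℤ := n + 1 - k with ha
  set b : ℤ := n + 1 + k with hb
  have r := fun m => invQFactorial_sub_one hQ m
  have e1 : (n : ℤ) - k = a - 1 := by lia
  have e2 : (n : ℤ) + k = b - 1 := by lia
  have e3 : (n : ℤ) - (k - 1) = a := by lia
  have e4 : (n : ℤ) + (k - 1) = b - 1 - 1 := by lia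
  have e5 : (n : ℤ) - (k + 1) = a - 1 - 1 := by lia
  have e6 : (n : ℤ) + (k + 1) = b := by lia
  have e7 : ((n + 1 : ℕ) : ℤ) - k = a := by lia
  have e8 : ((n + 1 : ℕ) : ℤ) + k = b := by lia
  have p1 : q ^ (2 * n + 1) * q ^ ((k - 1) ^ 2) = q ^ (k ^ 2) * Q ^ a := by
    rw [hQdef, ← zpow_natCast q 2, ← zpow_mul, ← zpow_natCast, ← zpow_add₀ hq0, ← zpow_add₀ hq0]
    congr 1; push_cast; rw [ha]; ring
  have p2 : q ^ (2 * n + 1) * q ^ ((k + 1) ^ 2) = q ^ (k ^ 2) * Q ^ b := by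
    rw [hQdef, ← zpow_natCast q 2, ← zpow_mul, ← zpow_natCast, ← zpow_add₀ hq0, ← zpow_add₀ hq0]
    congr 1; push_cast; rw [hb]; ring
  have p3 : q ^ (4 * n + 2) = Q ^ a * Q ^ b * Q⁻¹ := by
    rw [← zpow_neg_one, ← zpow_add₀ hQ0, ← zpow_add₀ hQ0, hQdef, ← zpow_natCast q 2, ← zpow_mul,
      ← zpow_natCast]
    congr 1; push_cast; rw [ha, hb]; ring
  have p4 : Q ^ (2 * n + 1) = Q ^ a * Q ^ b * Q⁻¹ := by
    rw [← p3, hQdef, ← pow_mul]; ring_nf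
  have p5 : Q ^ (2 * n + 1 + 1) = Q ^ a * Q ^ b := by
    rw [pow_succ, p4]; field_simp
  have p6 : qFactorial Q (2 * (n + 1)) =
      qFactorial Q (2 * n) * (1 - Q ^ (2 * n + 1)) * (1 - Q ^ (2 * n + 1 + 1)) := by
    rw [show 2 * (n + 1) = 2 * n + 1 + 1 by ring]
    simp only [qFactorial, Finset.prod_range_succ]
  rw [← mul_assoc (q ^ (2 * n + 1)), ← mul_assoc (q ^ (2 * n + 1)), p1, p2]
  simp only [tripleCoeff]
  clear_value a b Q
  rw [e1, e2, e3, e4, e5, e6, p6, p3, p4, p5, e7, e8, r (b - 1), r (a - 1), r a, r b,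
    zpow_sub₀ hQ0, zpow_sub₀ hQ0, zpow_one]
  field_simp
  ring

lemma hasSum_finite_triple {q x : ℂ} (hq : ‖q‖ < 1) (hq0 : q ≠ 0) (hx : x ≠ 0) (n : ℕ) :
    HasSum (fun k : ℤ => q ^ (k ^ 2) * tripleCoeff (q ^ 2) n k * x ^ k)
      (∏ i ∈ Finset.range n, ((1 + q ^ (2 * i + 1) * x) * (1 + q ^ (2 * i + 1) * x⁻¹))) := by
  induction n with
  | zero =>
    have := hasSum_single (f := fun k : ℤ => q ^ (k ^ 2) * tripleCoeff (q ^ 2) 0 k * x ^ k) 0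
      (fun k hk => by
        rcases lt_or_gt_of_ne hk with h | h
        · simp [tripleCoeff, invQFactorial, show ¬ (0 ≤ k) by lia]
        · simp [tripleCoeff, invQFactorial, show ¬ (k ≤ 0) by lia])
    simpa [tripleCoeff, invQFactorial, qFactorial] using this
  | succ n ih =>
    have h1 := ih.mul_left (1 + q ^ (4 * n + 2))
    have h2 := ((Equiv.subRight (1 : ℤ)).hasSum_iff.mpr ih).mul_left (q ^ (2 * n + 1) * x)
    have h3 := ((Equiv.addRight (1 : ℤ)).hasSum_iff.mpr ih).mul_left (q ^ (2 * n + 1) * x⁻¹)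
    have e : (fun k : ℤ => q ^ (k ^ 2) * tripleCoeff (q ^ 2) (n + 1) k * x ^ k) = _ :=
      funext fun k => show _ = (1 + q ^ (4 * n + 2)) *
          (q ^ (k ^ 2) * tripleCoeff (q ^ 2) n k * x ^ k) + q ^ (2 * n + 1) * x *
          (q ^ ((k - 1) ^ 2) * tripleCoeff (q ^ 2) n (k - 1) * x ^ (k - 1)) +
          q ^ (2 * n + 1) * x⁻¹ *
          (q ^ ((k + 1) ^ 2) * tripleCoeff (q ^ 2) n (k + 1) * x ^ (k + 1)) by
        rw [tripleCoeff_succ hq hq0 n k, zpow_sub₀ hx, zpow_add₀ hx, zpow_one]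
        field_simp
    rw [e, Finset.prod_range_succ]
    convert! (h1.add h2).add h3 using 1
    field_simp
    ring_nf

lemma norm_sq_lt_one {q : ℂ} (hq : ‖q‖ < 1) : ‖q ^ 2‖ < 1 := by
  rw [norm_pow]; exact pow_lt_one₀ (norm_nonneg q) hq two_ne_zero

lemma summable_norm_mul_pow {Q : ℂ} (hQ : ‖Q‖ < 1) (a b : ℂ) {d : ℕ} (hd : d ≠ 0) :
    Summable fun i : ℕ => ‖a * (Q ^ (d * i) * b)‖ := by
  have h : ‖Q ^ d‖ < 1 := by rw [norm_pow]; exact pow_lt_one₀ (norm_nonneg _) hQ hd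
  have := (summable_geometric_of_norm_lt_one h).norm.mul_left (‖a‖ * ‖b‖)
  refine this.congr fun i => ?_
  simp only [norm_mul, pow_mul]
  ring

/-- `∏_{n ≥ 0} (1 + y q ^ (d n))`. -/
def qProd (q y : ℂ) (d : ℕ) : ℂ := ∏' n : ℕ, (1 + q ^ (d * n) * y)

lemma multipliable_qProd {q : ℂ} (hq : ‖q‖ < 1) (y : ℂ) {d : ℕ} (hd : d ≠ 0) :
    Multipliable fun n : ℕ => 1 + q ^ (d * n) * y :=
  multipliable_one_add_of_summable (by simpa using summable_norm_mul_pow hq 1 y hd)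

lemma tendsto_qProd {q : ℂ} (hq : ‖q‖ < 1) (y : ℂ) {d : ℕ} (hd : d ≠ 0) :
    Filter.Tendsto (fun n => ∏ i ∈ Finset.range n, (1 + q ^ (d * i) * y))
    Filter.atTop (𝓝 (qProd q y d)) :=
  (multipliable_qProd hq y hd).hasProd.tendsto_prod_nat

lemma qProd_ne_zero {q : ℂ} (hq : ‖q‖ < 1) (y : ℂ) {d : ℕ} (hd : d ≠ 0)
    (h : ∀ n : ℕ, 1 + q ^ (d * n) * y ≠ 0) : qProd q y d ≠ 0 :=
  tprod_one_add_ne_zero_of_summable h (by simpa using summable_norm_mul_pow hq 1 y hd)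

lemma qProd_succ {q : ℂ} (hq : ‖q‖ < 1) (y : ℂ) {d : ℕ} (hd : d ≠ 0) :
    qProd q y d = (1 + y) * qProd q (q ^ d * y) d := by
  have h1 := (tendsto_qProd hq y hd).comp (Filter.tendsto_add_atTop_nat 1)
  have h2 := (tendsto_qProd hq (q ^ d * y) hd).const_mul (1 + y)
  refine tendsto_nhds_unique h1 (h2.congr fun n => ?_)
  simp only [Function.comp_apply]
  rw [Finset.prod_range_succ', mul_zero, pow_zero, one_mul, mul_comm]
  congr 1
  refine Finset.prod_congr rfl fun i _ => ?_
  ring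

lemma qFactorial_eq_prod (q : ℂ) (n : ℕ) :
    qFactorial (q ^ 2) n = ∏ i ∈ Finset.range n, (1 + q ^ (2 * i) * (-q ^ 2)) := by
  refine Finset.prod_congr rfl fun i _ => ?_
  ring

lemma tendsto_qFactorial {q : ℂ} (hq : ‖q‖ < 1) :
    Filter.Tendsto (qFactorial (q ^ 2)) Filter.atTop (𝓝 (qProd q (-q ^ 2) 2)) := by
  exact (tendsto_qProd hq (-q ^ 2) two_ne_zero).congr fun n => (qFactorial_eq_prod q n).symm

lemma qProd_neg_sq_ne_zero {q : ℂ} (hq : ‖q‖ < 1) : qProd q (-q ^ 2) 2 ≠ 0 := by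
  refine qProd_ne_zero hq _ two_ne_zero fun n => ?_
  convert one_sub_pow_ne_zero (norm_sq_lt_one hq) n using 1
  ring

/-- The q-factorials converge to a nonzero limit, so their inverses are bounded. This supplies the
dominating series in the triple product. -/
lemma exists_norm_invQFactorial_le {q : ℂ} (hq : ‖q‖ < 1) :
    ∃ M, ∀ m : ℤ, ‖invQFactorial (q ^ 2) m‖ ≤ M := by
  have h := (tendsto_qFactorial hq).inv₀ (qProd_neg_sq_ne_zero hq)
  obtain ⟨M, hM⟩ := h.norm.bddAbove_range
  refine ⟨M, fun m => ?_⟩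
  have hM' : ∀ n : ℕ, ‖(qFactorial (q ^ 2) n)⁻¹‖ ≤ M := fun n => hM ⟨n, rfl⟩
  by_cases hm : 0 ≤ m
  · simpa [invQFactorial, hm] using hM' m.toNat
  · simpa [invQFactorial, hm] using (norm_nonneg _).trans (hM' 0)

lemma tendsto_invQFactorial {q : ℂ} (hq : ‖q‖ < 1) (k : ℤ) :
    Filter.Tendsto (fun n : ℕ => invQFactorial (q ^ 2) (n + k)) Filter.atTop
      (𝓝 (qProd q (-q ^ 2) 2)⁻¹) := by
  have h := (tendsto_qFactorial hq).inv₀ (qProd_neg_sq_ne_zero hq)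
  have h2 : Filter.Tendsto (fun n : ℕ => ((n : ℤ) + k).toNat) Filter.atTop Filter.atTop := by
    refine Filter.tendsto_atTop.mpr fun b => ?_
    filter_upwards [Filter.eventually_ge_atTop (b + k.natAbs)] with n hn
    lia
  refine (h.comp h2).congr' ?_
  filter_upwards [Filter.eventually_ge_atTop k.natAbs] with n hn
  simp [invQFactorial, show 0 ≤ (n : ℤ) + k by lia]

lemma norm_cexp_pi_mul_I_lt_one (τ : ℍ) : ‖cexp (π * I * τ)‖ < 1 := by
  rw [Complex.norm_exp, Real.exp_lt_one_iff]
  have : (π * I * τ : ℂ).re = -(π * τ.im) := by simp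
  rw [this]
  exact neg_neg_of_pos (mul_pos Real.pi_pos τ.im_pos)

/-- **Jacobi triple product.** -/
theorem jacobiTheta₂_eq_prod (z : ℂ) (τ : ℍ) {q x : ℂ} (hq : q = cexp (π * I * τ))
    (hx : x = cexp (2 * π * I * z)) :
    jacobiTheta₂ z τ =
      qProd q (-q ^ 2) 2 * (qProd q (q * x) 2 * qProd q (q * x⁻¹) 2) := by
  have hq1 : ‖q‖ < 1 := hq ▸ norm_cexp_pi_mul_I_lt_one τ
  have hq0 : q ≠ 0 := hq ▸ Complex.exp_ne_zero _
  have hx0 : x ≠ 0 := hx ▸ Complex.exp_ne_zero _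
  have hterm : ∀ k : ℤ, jacobiTheta₂_term k z τ = q ^ (k ^ 2) * x ^ k := fun k => by
    rw [jacobiTheta₂_term, hq, hx, ← Complex.exp_int_mul, ← Complex.exp_int_mul, ← Complex.exp_add]
    congr 1
    push_cast
    ring
  have hS : Summable fun k : ℤ => q ^ (k ^ 2) * x ^ k := by
    simpa only [hterm] using (hasSum_jacobiTheta₂_term z τ.im_pos).summable
  obtain ⟨M₁, hM₁⟩ := (tendsto_qFactorial hq1).norm.bddAbove_range
  have hM₁' : ∀ n : ℕ, ‖qFactorial (q ^ 2) n‖ ≤ M₁ := fun n => hM₁ ⟨n, rfl⟩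
  obtain ⟨M₂, hM₂⟩ := exists_norm_invQFactorial_le hq1
  set G := qProd q (-q ^ 2) 2 with hG
  have hG0 : G ≠ 0 := qProd_neg_sq_ne_zero hq1
  -- With G the limit of the q-factorials, each coefficient of the finite identity tends to G · G⁻¹
  -- · G⁻¹ = G⁻¹, and dominated convergence moves the limit inside the sum.
  have hlim : Filter.Tendsto (fun n : ℕ => ∑' k : ℤ, q ^ (k ^ 2) * tripleCoeff (q ^ 2) n k * x ^ k)
      Filter.atTop (𝓝 (∑' k : ℤ, q ^ (k ^ 2) * G⁻¹ * x ^ k)) := by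
    refine tendsto_tsum_of_dominated_convergence
      (bound := fun k => M₁ * (M₂ * M₂) * ‖q ^ (k ^ 2) * x ^ k‖) (hS.norm.mul_left _) ?_ ?_
    · intro k
      refine Filter.Tendsto.mul_const _ (Filter.Tendsto.const_mul _ ?_)
      have h1 := ((tendsto_qFactorial hq1).comp
        (Filter.tendsto_id.const_mul_atTop' (two_pos : 0 < 2))).mul
        ((tendsto_invQFactorial hq1 (-k)).mul (tendsto_invQFactorial hq1 k))
      rw [← hG, mul_inv_cancel_left₀ hG0] at h1
      simpa [tripleCoeff, Function.comp_def, sub_eq_add_neg] using h1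
    · refine Filter.Eventually.of_forall fun n k => ?_
      have h0 : 0 ≤ M₁ := (norm_nonneg _).trans (hM₁' 0)
      have h2 : 0 ≤ M₂ := (norm_nonneg _).trans (hM₂ 0)
      calc _ = ‖tripleCoeff (q ^ 2) n k‖ * ‖q ^ (k ^ 2) * x ^ k‖ := by
            simp only [norm_mul]; ring
        _ ≤ _ := by
            refine mul_le_mul_of_nonneg_right ?_ (norm_nonneg _)
            rw [tripleCoeff, norm_mul, norm_mul]
            gcongr
            exacts [hM₁' _, hM₂ _, hM₂ _]
  have hlim2 : Filter.Tendsto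
      (fun n : ℕ => ∑' k : ℤ, q ^ (k ^ 2) * tripleCoeff (q ^ 2) n k * x ^ k)
      Filter.atTop (𝓝 (qProd q (q * x) 2 * qProd q (q * x⁻¹) 2)) := by
    refine ((tendsto_qProd hq1 (q * x) two_ne_zero).mul
      (tendsto_qProd hq1 (q * x⁻¹) two_ne_zero)).congr fun n => ?_
    rw [(hasSum_finite_triple hq1 hq0 hx0 n).tsum_eq, ← Finset.prod_mul_distrib]
    refine Finset.prod_congr rfl fun i _ => ?_
    ring
  rw [← tendsto_nhds_unique hlim hlim2, ← tsum_mul_left, jacobiTheta₂]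
  refine tsum_congr fun k => ?_
  rw [hterm]
  field_simp

lemma qProd_even_odd {q : ℂ} (hq : ‖q‖ < 1) (y : ℂ) {d : ℕ} (hd : d ≠ 0) :
    qProd q y d = qProd q y (2 * d) * qProd q (q ^ d * y) (2 * d) := by
  have h2 : 2 * d ≠ 0 := mul_ne_zero two_ne_zero hd
  have h1 := (tendsto_qProd hq y hd).comp
    (Filter.tendsto_id.const_mul_atTop' (two_pos : 0 < 2))
  refine tendsto_nhds_unique h1 (((tendsto_qProd hq y h2).mul
    (tendsto_qProd hq (q ^ d * y) h2)).congr fun n => ?_)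
  simp only [Function.comp_apply, id]
  induction n with
  | zero => simp
  | succ n ih =>
    rw [Finset.prod_range_succ, Finset.prod_range_succ, show 2 * (n + 1) = 2 * n + 1 + 1 by ring,
      Finset.prod_range_succ, Finset.prod_range_succ, ← ih]
    ring

lemma qProd_mul_neg {q : ℂ} (hq : ‖q‖ < 1) (y : ℂ) {d : ℕ} (hd : d ≠ 0) :
    qProd q y d * qProd q (-y) d = qProd q (-y ^ 2) (2 * d) := by
  have h2 : 2 * d ≠ 0 := mul_ne_zero two_ne_zero hd
  refine tendsto_nhds_unique ((tendsto_qProd hq y hd).mul (tendsto_qProd hq (-y) hd))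
    ((tendsto_qProd hq (-y ^ 2) h2).congr fun n => ?_)
  rw [← Finset.prod_mul_distrib]
  refine Finset.prod_congr rfl fun i _ => ?_
  ring

/-- Euler's identity `∏ (1 + q^{2n}) (1 + q^{2n-1}) (1 - q^{2n-1}) = 1`. -/
lemma qProd_euler {q : ℂ} (hq : ‖q‖ < 1) :
    qProd q (q ^ 2) 2 * (qProd q q 2 * qProd q (-q) 2) = 1 := by
  have h0 := qProd_neg_sq_ne_zero hq
  have h1 : qProd q (q ^ 2) 2 * qProd q (-q ^ 2) 2 = qProd q (-(q ^ 2) ^ 2) (2 * 2) :=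
    qProd_mul_neg hq _ two_ne_zero
  have h2 : qProd q q 2 * qProd q (-q) 2 = qProd q (-q ^ 2) (2 * 2) :=
    qProd_mul_neg hq _ two_ne_zero
  have h3 := qProd_even_odd hq (-q ^ 2) two_ne_zero
  rw [show q ^ 2 * -q ^ 2 = -(q ^ 2) ^ 2 by ring] at h3
  -- After multiplication by ∏ (1 - q^(2n)), the left side becomes the product of 1 - q^j over j ≡ 0
  -- and j ≡ 2 mod 4, that is, ∏ (1 - q^(2n)) again.
  refine mul_right_cancel₀ h0 ?_
  rw [h2, one_mul]
  linear_combination qProd q (-q ^ 2) (2 * 2) * h1 - h3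

/-- Uniform convergence on closed balls. Continuity of the nonvanishing cofactor is all that the
derivative of θ₄ at its zero requires. -/
lemma continuous_qProd {q : ℂ} (hq : ‖q‖ < 1) {d : ℕ} (hd : d ≠ 0) :
    Continuous fun y => qProd q y d := by
  refine continuous_iff_continuousAt.mpr fun y₀ => ?_
  have hK : IsCompact (Metric.closedBall (0 : ℂ) (‖y₀‖ + 1)) := isCompact_closedBall _ _
  have hs : Summable fun n : ℕ => ‖(1 : ℂ) * (q ^ (d * n) * ((‖y₀‖ + 1 : ℝ) : ℂ))‖ :=
    summable_norm_mul_pow hq _ _ hd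
  have h := hs.hasProdUniformlyOn_nat_one_add (f := fun n y => q ^ (d * n) * y) hK
    (Filter.Eventually.of_forall fun n y hy => by
      rw [mem_closedBall_zero_iff] at hy
      rw [one_mul, norm_mul, norm_mul, Complex.norm_real, Real.norm_of_nonneg (by positivity)]
      gcongr) (fun n => by fun_prop)
  rw [hasProdUniformlyOn_iff_tendstoUniformlyOn] at h
  have hc : ContinuousOn (fun y => qProd q y d) (Metric.closedBall (0 : ℂ) (‖y₀‖ + 1)) :=
    h.continuousOn (Filter.Frequently.of_forall fun s => by fun_prop)
  refine hc.continuousAt (Filter.mem_of_superset (Metric.ball_mem_nhds y₀ one_pos) fun y hy => ?_)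
  rw [mem_ball_iff_norm] at hy
  rw [mem_closedBall_zero_iff]
  have := norm_add_le y₀ (y - y₀)
  rw [add_sub_cancel] at this
  linarith

/-! ### Zeros of theta functions -/

/-- The points `(2m+1)τ + 2n`, at which the function `v ↦ cn(K v)` has its poles. -/
def polePoint (τ : ℍ) (p : ℤ × ℤ) : ℂ := (2 * (p.1 : ℂ) + 1) * τ + 2 * p.2

lemma im_polePoint (τ : ℍ) (p : ℤ × ℤ) : (polePoint τ p).im = (2 * p.1 + 1) * τ.im := by
  simp [polePoint]

/-- The coefficient of τ is odd, hence at least 1 in absolute value. So no pole is real, and the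
disc |v| < Im τ is free of poles. -/
lemma im_le_abs_im_polePoint (τ : ℍ) (p : ℤ × ℤ) : τ.im ≤ |(polePoint τ p).im| := by
  rw [im_polePoint, abs_mul, abs_of_pos τ.im_pos]
  refine le_mul_of_one_le_left τ.im_pos.le ?_
  have : (1 : ℤ) ≤ |2 * p.1 + 1| := Int.one_le_abs (by lia)
  exact_mod_cast this

lemma im_le_norm_polePoint (τ : ℍ) (p : ℤ × ℤ) : τ.im ≤ ‖polePoint τ p‖ :=
  (im_le_abs_im_polePoint τ p).trans (Complex.abs_im_le_norm _)

lemma polePoint_ne_zero (τ : ℍ) (p : ℤ × ℤ) : polePoint τ p ≠ 0 :=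
  norm_pos_iff.mp (τ.im_pos.trans_le (im_le_norm_polePoint τ p))

/-- A factor of the triple product vanishes only if q^(2k+1) x^(±1) = -1; comparing exponents modulo
2πi makes v a pole point. -/
lemma jacobiTheta₂_ne_zero (τ : ℍ) {v : ℂ} (hv : ∀ p, v ≠ polePoint τ p) :
    jacobiTheta₂ (v / 2 + 1 / 2) τ ≠ 0 := by
  have hq1 := norm_cexp_pi_mul_I_lt_one τ
  have key : ∀ (k : ℕ) (ε : ℤˣ), cexp (π * I * τ) ^ (2 * k) *
      (cexp (π * I * τ) * cexp (2 * π * I * (v / 2 + 1 / 2)) ^ (ε : ℤ)) ≠ -1 := by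
    intro k ε h
    rw [← Complex.exp_nat_mul, ← Complex.exp_int_mul, ← Complex.exp_add, ← Complex.exp_add,
      ← Complex.exp_pi_mul_I, Complex.exp_eq_exp_iff_exists_int] at h
    obtain ⟨n, hn⟩ := h
    have hpi : (π : ℂ) * I ≠ 0 := mul_ne_zero (by exact_mod_cast Real.pi_ne_zero) I_ne_zero
    have hn2 : (2 * (k : ℂ) + 1) * τ + (ε : ℤ) * (v + 1) = 1 + 2 * n := by
      refine mul_left_cancel₀ hpi ?_
      push_cast at hn
      linear_combination hn
    rcases Int.units_eq_one_or ε with rfl | rfl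
    · refine hv (-k - 1, n) ?_
      simp only [polePoint]
      push_cast at hn2 ⊢
      linear_combination hn2
    · refine hv (k, -n - 1) ?_
      simp only [polePoint]
      push_cast at hn2 ⊢
      linear_combination -hn2
  rw [jacobiTheta₂_eq_prod _ τ rfl rfl]
  refine mul_ne_zero (qProd_neg_sq_ne_zero hq1) (mul_ne_zero ?_ ?_)
  · refine qProd_ne_zero hq1 _ two_ne_zero fun k h => key k 1 ?_
    rw [Units.val_one, zpow_one]
    linear_combination h
  · refine qProd_ne_zero hq1 _ two_ne_zero fun k h => key k (-1) ?_
    rw [Units.val_neg, Units.val_one, zpow_neg_one]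
    linear_combination h

lemma ofReal_ne_polePoint (τ : ℍ) (x : ℝ) (p : ℤ × ℤ) : (x : ℂ) ≠ polePoint τ p := by
  intro h
  have h1 := im_le_abs_im_polePoint τ p
  rw [← h, Complex.ofReal_im, abs_zero] at h1
  exact absurd h1 (not_le.mpr τ.im_pos)

lemma jacobiTheta₂_zero_ne_zero (τ : ℍ) : jacobiTheta₂ 0 τ ≠ 0 := by
  have := jacobiTheta₂_ne_zero τ (v := -1) fun p => by simpa using ofReal_ne_polePoint τ (-1) p
  rwa [show (-1 : ℂ) / 2 + 1 / 2 = 0 by norm_num] at this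

lemma Theta3_eq (τ : ℍ) : Theta3 τ = jacobiTheta₂ 0 τ := by
  rw [Theta3, jacobiTheta₂]
  refine tsum_congr fun n => ?_
  rw [jacobiTheta₂_term]
  congr 1
  ring

lemma Theta3_ne_zero (τ : ℍ) : Theta3 τ ≠ 0 := Theta3_eq τ ▸ jacobiTheta₂_zero_ne_zero τ

lemma Theta2_eq (τ : ℍ) : Theta2 τ = cexp (π * I * τ / 4) * jacobiTheta₂ (τ / 2) τ := by
  rw [← jacobiThetaTwo_zero, jacobiThetaTwo]
  simp

lemma jacobiTheta₂_half_ne_zero (τ : ℍ) : jacobiTheta₂ (τ / 2) τ ≠ 0 := by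
  -- Θ₂ is, up to an exponential, the same function at v = τ - 1. Were this a pole point, the
  -- imaginary part would force m = 0, and then -1 = 2n.
  have := jacobiTheta₂_ne_zero τ (v := τ - 1) fun p h => by
    have him := congrArg Complex.im h
    have hre := congrArg Complex.re h
    rw [im_polePoint] at him
    simp only [sub_im, coe_im, one_im, sub_zero] at him
    have h1 : (2 * (p.1 : ℝ) + 1) = 1 := by
      have := τ.im_pos
      refine mul_right_cancel₀ this.ne' ?_
      rw [← him, one_mul]
    have h2 : p.1 = 0 := by
      have : (p.1 : ℝ) = 0 := by linarith
      exact_mod_cast this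
    simp [polePoint, h2] at hre
    have h3 : (-1 : ℤ) = 2 * p.2 := by
      have : (-1 : ℝ) = 2 * p.2 := by linarith
      exact_mod_cast this
    lia
  convert this using 2
  ring

lemma Theta2_ne_zero (τ : ℍ) : Theta2 τ ≠ 0 := by
  rw [Theta2_eq]
  exact mul_ne_zero (Complex.exp_ne_zero _) (jacobiTheta₂_half_ne_zero τ)

/-- The product of the theta constants. -/
lemma prod_theta_constants (τ : ℍ) :
    Theta2 τ * Theta3 τ * jacobiThetaFour 0 τ =
      2 * cexp (π * I * τ / 4) * qProd (cexp (π * I * τ)) (-cexp (π * I * τ) ^ 2) 2 ^ 3 := by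
  have hq1 := norm_cexp_pi_mul_I_lt_one τ
  rw [Theta2_eq, Theta3_eq, jacobiThetaFour, zero_div, zero_add,
    jacobiTheta₂_eq_prod (τ / 2) τ (q := cexp (π * I * τ)) (x := cexp (π * I * τ)) rfl
      (by congr 1; ring),
    jacobiTheta₂_eq_prod 0 τ (q := cexp (π * I * τ)) (x := 1) rfl (by simp),
    jacobiTheta₂_eq_prod (1 / 2) τ (q := cexp (π * I * τ)) (x := -1) rfl
      (by rw [← Complex.exp_pi_mul_I]; congr 1; ring)]
  set q := cexp (π * I * τ) with hq
  have hq0 : q ≠ 0 := Complex.exp_ne_zero _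
  -- For x = q the product with q x⁻¹ = 1 begins with 1 + 1, the source of the factor 2. The other
  -- products occur squared and disappear by Euler's identity.
  have h1 := qProd_succ hq1 1 two_ne_zero
  have h2 := qProd_euler hq1
  rw [mul_inv_cancel₀ hq0, h1, inv_one, mul_one, mul_one, show (-1 : ℂ)⁻¹ = -1 by norm_num,
    mul_neg_one, ← sq q]
  generalize qProd q (q ^ 2) 2 = A at *
  generalize qProd q q 2 = B at *
  generalize qProd q (-q) 2 = D at *
  generalize qProd q (-q ^ 2) 2 = G at *
  have h3 : (A * (B * D)) ^ 2 = 1 := by rw [h2, one_pow]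
  linear_combination (2 * cexp (π * I * τ / 4) * G ^ 3) * h3

/-- The derivative of `v ↦ θ₄(π v / 2)` at its zero `τ`. -/
lemma hasDerivAt_jacobiTheta₂_zero (τ : ℍ) :
    HasDerivAt (fun v : ℂ => jacobiTheta₂ (v / 2 + 1 / 2) τ)
      (π * I * qProd (cexp (π * I * τ)) (-cexp (π * I * τ) ^ 2) 2 ^ 3) τ := by
  have hq1 := norm_cexp_pi_mul_I_lt_one τ
  set q := cexp (π * I * τ) with hq
  have hq0 : q ≠ 0 := Complex.exp_ne_zero _
  set G := qProd q (-q ^ 2) 2 with hG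
  -- The factor `h` that vanishes at τ is split off the second infinite product, and `k` collects
  -- the rest. As `h τ = 0`, the slope of `h * k` at τ is the slope of `h` times `k`, so `k` need
  -- only be continuous.
  let k : ℂ → ℂ := fun v => G * (qProd q (q * -cexp (π * I * v)) 2 *
    qProd q (q ^ 2 * (q * -cexp (-(π * I * v)))) 2)
  let h : ℂ → ℂ := fun v => 1 - cexp (π * I * (τ - v))
  have hN : ∀ v : ℂ, jacobiTheta₂ (v / 2 + 1 / 2) τ = h v * k v := fun v => by
    rw [jacobiTheta₂_eq_prod _ τ hq (x := -cexp (π * I * v))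
      (by rw [← neg_one_mul, ← Complex.exp_pi_mul_I, ← Complex.exp_add]; congr 1; ring),
      inv_neg, ← Complex.exp_neg, qProd_succ hq1 (q * -cexp (-(π * I * v))) two_ne_zero]
    have : h v = 1 + q * -cexp (-(π * I * v)) := by
      simp only [h]
      rw [mul_neg, ← sub_eq_add_neg, hq, ← Complex.exp_add]
      congr 2
      ring
    rw [this]
    simp only [k]
    ring
  have hk : ContinuousAt k τ := by
    have hc := continuous_qProd hq1 (two_ne_zero : (2 : ℕ) ≠ 0)
    have h1 : Continuous k := by
      refine continuous_const.mul ((hc.comp ?_).mul (hc.comp ?_)) <;> fun_prop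
    exact h1.continuousAt
  have hkτ : k τ = G ^ 3 := by
    simp only [k]
    rw [Complex.exp_neg, ← hq, mul_neg, mul_neg, mul_inv_cancel₀ hq0, ← sq, ← hG, mul_neg_one,
      ← hG]
    ring
  have hh : HasDerivAt h (π * I) τ := by
    have h1 : HasDerivAt (fun v : ℂ => π * I * (τ - v)) (π * I * (-1)) τ :=
      ((hasDerivAt_id _).const_sub _).const_mul _
    have h2 := h1.cexp.const_sub 1
    simpa using h2
  have hhτ : h τ = 0 := by simp [h]
  rw [hasDerivAt_iff_tendsto_slope] at hh ⊢
  refine Filter.Tendsto.congr (f₁ := fun v => slope h τ v * k v) (fun v => ?_) ?_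
  · simp only [slope_def_field, hN, hhτ]
    ring
  · rw [← hkτ]
    exact hh.mul (hk.tendsto.mono_left nhdsWithin_le_nhds)

/-! ### The function `v ↦ cn(K v)` -/

/-- The function `v ↦ cn(K v)`, that is, `cn` normalized to have real quarter period `1`. -/
def cnNormalized (τ : ℍ) (v : ℂ) : ℂ :=
  jacobiThetaFour 0 τ / jacobiThetaTwo 0 τ *
    (jacobiThetaTwo (π * v / 2) τ / jacobiThetaFour (π * v / 2) τ)

lemma quarterPeriod_ne_zero (τ : ℍ) : quarterPeriod τ ≠ 0 := by
  have hpi : (π : ℂ) ≠ 0 := by exact_mod_cast Real.pi_ne_zero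
  exact mul_ne_zero (div_ne_zero hpi two_ne_zero) (pow_ne_zero 2 (Theta3_ne_zero τ))

lemma jacobiCn_eq (τ : ℍ) (u : ℂ) : jacobiCn τ u = cnNormalized τ (u / quarterPeriod τ) := by
  have h : π * u / (2 * quarterPeriod τ) = π * (u / quarterPeriod τ) / 2 := by
    have := quarterPeriod_ne_zero τ
    field_simp
  rw [jacobiCn, cnNormalized, h]

lemma jacobiThetaFour_pi_mul (τ : ℍ) (v : ℂ) :
    jacobiThetaFour (π * v / 2) τ = jacobiTheta₂ (v / 2 + 1 / 2) τ := by
  have hpi : (π : ℂ) ≠ 0 := by exact_mod_cast Real.pi_ne_zero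
  rw [jacobiThetaFour]
  congr 2
  field_simp

lemma jacobiThetaTwo_pi_mul (τ : ℍ) (v : ℂ) :
    jacobiThetaTwo (π * v / 2) τ =
      cexp (π * I * τ / 4 + π * I * v / 2) * jacobiTheta₂ (v / 2 + τ / 2) τ := by
  have hpi : (π : ℂ) ≠ 0 := by exact_mod_cast Real.pi_ne_zero
  rw [jacobiThetaTwo]
  congr 3
  · ring
  · field_simp

lemma cnNormalized_eq (τ : ℍ) (v : ℂ) : cnNormalized τ v =
    jacobiThetaFour 0 τ / Theta2 τ * (cexp (π * I * τ / 4 + π * I * v / 2) *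
      jacobiTheta₂ (v / 2 + τ / 2) τ / jacobiTheta₂ (v / 2 + 1 / 2) τ) := by
  rw [cnNormalized, jacobiThetaFour_pi_mul, jacobiThetaTwo_pi_mul, jacobiThetaTwo_zero]

lemma cnNormalized_add_two (τ : ℍ) (v : ℂ) : cnNormalized τ (v + 2) = -cnNormalized τ v := by
  simp only [cnNormalized_eq]
  rw [show (v + 2) / 2 + (τ : ℂ) / 2 = v / 2 + τ / 2 + 1 by ring,
    show (v + 2) / 2 + (1 : ℂ) / 2 = v / 2 + 1 / 2 + 1 by ring, jacobiTheta₂_add_left,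
    jacobiTheta₂_add_left,
    show π * I * τ / 4 + π * I * (v + 2) / 2 = π * I * τ / 4 + π * I * v / 2 + π * I by ring,
    Complex.exp_add _ (π * I), Complex.exp_pi_mul_I]
  ring

/-- Numerator and denominator acquire quasi-period multipliers whose ratio, with the exponential
prefactor included, is exp(πi) = -1. -/
lemma cnNormalized_add_two_mul (τ : ℍ) (v : ℂ) :
    cnNormalized τ (v + 2 * τ) = -cnNormalized τ v := by
  simp only [cnNormalized_eq]
  rw [show (v + 2 * (τ : ℂ)) / 2 + (τ : ℂ) / 2 = v / 2 + τ / 2 + τ by ring,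
    show (v + 2 * (τ : ℂ)) / 2 + (1 : ℂ) / 2 = v / 2 + 1 / 2 + τ by ring, jacobiTheta₂_add_left',
    jacobiTheta₂_add_left', ← mul_assoc (cexp _) (cexp _), ← Complex.exp_add]
  have h : π * I * τ / 4 + π * I * (v + 2 * τ) / 2 + -π * I * (τ + 2 * (v / 2 + τ / 2)) =
      π * I * τ / 4 + π * I * v / 2 + (π * I + -π * I * (τ + 2 * (v / 2 + 1 / 2))) := by ring
  rw [h, Complex.exp_add, Complex.exp_add (π * I), Complex.exp_pi_mul_I]
  have := Complex.exp_ne_zero (-π * I * (τ + 2 * (v / 2 + 1 / 2)))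
  generalize cexp (-π * I * (τ + 2 * (v / 2 + 1 / 2))) = e at *
  field_simp

lemma cnNormalized_neg (τ : ℍ) (v : ℂ) : cnNormalized τ (-v) = cnNormalized τ v := by
  simp only [cnNormalized_eq]
  have h1 : jacobiTheta₂ (-v / 2 + 1 / 2) τ = jacobiTheta₂ (v / 2 + 1 / 2) τ := by
    rw [← jacobiTheta₂_neg_left, ← jacobiTheta₂_add_left]
    congr 1
    ring
  have h2 : jacobiTheta₂ (v / 2 + τ / 2) τ =
      cexp (-π * I * v) * jacobiTheta₂ (-v / 2 + τ / 2) τ := by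
    rw [← jacobiTheta₂_neg_left (-v / 2 + τ / 2),
      show v / 2 + (τ : ℂ) / 2 = -(-v / 2 + τ / 2) + τ by ring, jacobiTheta₂_add_left']
    congr 2
    ring
  rw [h1, h2, ← mul_assoc (cexp _) (cexp _), ← Complex.exp_add]
  congr 4
  ring

lemma differentiable_jacobiTheta₂_half (τ : ℍ) (a : ℂ) :
    Differentiable ℂ fun v : ℂ => jacobiTheta₂ (v / 2 + a) τ := fun v =>
  (differentiableAt_jacobiTheta₂_fst (v / 2 + a) τ.im_pos).comp (f := fun v : ℂ => v / 2 + a) v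
    (by fun_prop)

lemma cnNormalized_analyticAt (τ : ℍ) {v : ℂ} (hv : ∀ p, v ≠ polePoint τ p) :
    AnalyticAt ℂ (cnNormalized τ) v := by
  have h1 : cnNormalized τ = fun v => jacobiThetaFour 0 τ / Theta2 τ *
      (cexp (π * I * τ / 4 + π * I * v / 2) *
      jacobiTheta₂ (v / 2 + τ / 2) τ / jacobiTheta₂ (v / 2 + 1 / 2) τ) :=
    funext (cnNormalized_eq τ)
  rw [h1]
  have h2 := (differentiable_jacobiTheta₂_half τ (τ / 2)).analyticAt v
  have h3 := (differentiable_jacobiTheta₂_half τ (1 / 2)).analyticAt v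
  have h4 : AnalyticAt ℂ (fun v : ℂ => cexp (π * I * τ / 4 + π * I * v / 2)) v :=
    Differentiable.analyticAt (by fun_prop) v
  exact analyticAt_const.mul ((h4.mul h2).div h3 (jacobiTheta₂_ne_zero τ hv))

/-- The residue of `v ↦ cn(K v)` at `τ`. -/
def cnResidue (τ : ℍ) : ℂ := -2 * I / (π * Theta2 τ ^ 2)

lemma _root_.AnalyticAt.dslope_self {f : ℂ → ℂ} {a : ℂ} (hf : AnalyticAt ℂ f a) :
    AnalyticAt ℂ (dslope f a) a := by
  obtain ⟨p, hp⟩ := hf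
  exact ⟨_, hp.has_fpower_series_dslope_fslope⟩

/-- The principal part of `v ↦ cn(K v)` at `τ`. -/
lemma cnNormalized_principal_part (τ : ℍ) : ∃ h : ℂ → ℂ, AnalyticAt ℂ h τ ∧
    ∀ v, v ≠ (τ : ℂ) → cnNormalized τ v = cnResidue τ / (v - τ) + h v := by
  set N : ℂ → ℂ := fun v => jacobiTheta₂ (v / 2 + 1 / 2) τ with hN
  have hτ : polePoint τ (0, 0) = τ := by simp [polePoint]
  set G := qProd (cexp (π * I * τ)) (-cexp (π * I * τ) ^ 2) 2 with hG
  have hG0 : G ≠ 0 := qProd_neg_sq_ne_zero (norm_cexp_pi_mul_I_lt_one τ)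
  have hpi : (π : ℂ) ≠ 0 := by exact_mod_cast Real.pi_ne_zero
  have hNd : HasDerivAt N (π * I * G ^ 3) τ := hasDerivAt_jacobiTheta₂_zero τ
  have hNa : AnalyticAt ℂ N τ := (differentiable_jacobiTheta₂_half τ (1 / 2)).analyticAt _
  -- Evenness and the two quasi-periods of the theta function, combined at the half period τ/2 +
  -- 1/2, give N τ = -N τ.
  have hN0 : N τ = 0 := by
    have h1 : (-(1 / 2) : ℂ) + τ / 2 + 1 = τ / 2 + 1 / 2 := by ring
    have h2 : (1 / 2 : ℂ) + -(τ / 2) + τ = τ / 2 + 1 / 2 := by ring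
    have h3 := jacobiTheta₂_add_left (-(1 / 2) + τ / 2) τ
    have h4 := jacobiTheta₂_add_left' (1 / 2 + -(τ / 2)) τ
    rw [← jacobiTheta₂_neg_left (1 / 2 + -(τ / 2)), h2] at h4
    rw [h1, show (-(1 / 2) : ℂ) + τ / 2 = -(1 / 2 + -(τ / 2)) by ring] at h3
    rw [show -π * I * (τ + 2 * (1 / 2 + -(τ / 2))) = -(π * I) by ring, Complex.exp_neg,
      Complex.exp_pi_mul_I, ← h3] at h4
    have h5 : N τ = -N τ := by
      simp only [hN]
      linear_combination h4
    exact self_eq_neg.mp h5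
  -- `R` is (v - τ) cn(Kv) with the singularity removed, since `dslope N τ` is N(v)/(v - τ) off τ.
  -- Its value at τ is the residue, and its own `dslope` is the regular part.
  let R : ℂ → ℂ := fun v => jacobiThetaFour 0 τ / Theta2 τ *
    (cexp (π * I * τ / 4 + π * I * v / 2) * jacobiTheta₂ (v / 2 + τ / 2) τ / dslope N τ v)
  have hdτ : dslope N τ τ = π * I * G ^ 3 := by rw [dslope_same, hNd.deriv]
  have hR : AnalyticAt ℂ R τ := by
    have h2 := (differentiable_jacobiTheta₂_half τ (τ / 2)).analyticAt τ
    have h4 : AnalyticAt ℂ (fun v : ℂ => cexp (π * I * τ / 4 + π * I * v / 2)) τ :=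
      Differentiable.analyticAt (by fun_prop) _
    refine analyticAt_const.mul ((h4.mul h2).div hNa.dslope_self ?_)
    rw [hdτ]
    exact mul_ne_zero (mul_ne_zero hpi I_ne_zero) (pow_ne_zero 3 hG0)
  have hRτ : R τ = cnResidue τ := by
    simp only [R, cnResidue]
    have h1 := prod_theta_constants τ
    rw [← hG] at h1
    have h0 := Theta2_ne_zero τ
    have h2 : jacobiTheta₂ ((τ : ℂ) / 2 + τ / 2) τ = cexp (-π * I * τ) * Theta3 τ := by
      have h := jacobiTheta₂_add_left' 0 τ
      rw [zero_add, mul_zero, add_zero, ← Theta3_eq] at h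
      rwa [add_halves]
    have h3 : cexp (π * I * τ / 4) * (cexp (π * I * τ / 4 + π * I * τ / 2) *
        cexp (-π * I * τ)) = 1 := by
      rw [← Complex.exp_add, ← Complex.exp_add, ← Complex.exp_zero]
      congr 1
      ring
    rw [hdτ, h2, div_mul_div_comm, div_eq_div_iff (by simp [hpi, h0, hG0]) (by simp [hpi, h0])]
    linear_combination (π * Theta2 τ * cexp (π * I * τ / 4 + π * I * τ / 2) *
        cexp (-π * I * τ)) * h1 + 2 * π * Theta2 τ * G ^ 3 * h3 +
        2 * π * Theta2 τ * G ^ 3 * I_sq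
  refine ⟨dslope R τ, hR.dslope_self, fun v hv => ?_⟩
  have hv' : v - τ ≠ 0 := sub_ne_zero.mpr hv
  rw [dslope_of_ne _ hv, slope_def_field, hRτ, ← add_div, add_sub_cancel, cnNormalized_eq]
  simp only [R]
  rw [dslope_of_ne _ hv, slope_def_field, hN0, sub_zero, div_div_eq_mul_div, mul_div_assoc,
    mul_div_assoc, mul_right_comm, mul_div_assoc, mul_div_assoc]
  simp only [hN]
  field_simp

/-! ### Sums over the set of poles -/

/-- The pole points are part of the lattice ℤτ + ℤ, so the convergence of Eisenstein series applies.
-/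
lemma summable_norm_polePoint_rpow (τ : ℍ) {k : ℝ} (hk : 2 < k) :
    Summable fun p : ℤ × ℤ => ‖polePoint τ p‖ ^ (-k) := by
  have hinj : Function.Injective fun p : ℤ × ℤ => (![2 * p.1 + 1, 2 * p.2] : Fin 2 → ℤ) := by
    rintro ⟨a, b⟩ ⟨c, d⟩ h
    have h0 := congrFun h 0
    have h1 := congrFun h 1
    simp at h0 h1
    simp [h0, h1]
  have h1 := ((EisensteinSeries.summable_one_div_norm_rpow hk).comp_injective hinj).mul_left
    (EisensteinSeries.r τ ^ (-k))
  refine Summable.of_nonneg_of_le (fun p => by positivity) (fun p => ?_) h1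
  have h2 := EisensteinSeries.summand_bound τ (by linarith : 0 ≤ k) ![2 * p.1 + 1, 2 * p.2]
  simpa [polePoint] using h2

lemma eventually_le_norm_polePoint (τ : ℍ) (B : ℝ) :
    ∀ᶠ p in Filter.cofinite, B ≤ ‖polePoint τ p‖ := by
  have h := (summable_norm_polePoint_rpow τ (k := 3) (by norm_num)).tendsto_cofinite_zero
  have hB : 0 < (max B 1) ^ (-3 : ℝ) := Real.rpow_pos_of_pos (by positivity) _
  filter_upwards [h.eventually_lt_const hB] with p hp
  by_contra! hlt
  have h0 : 0 < ‖polePoint τ p‖ := norm_pos_iff.mpr (polePoint_ne_zero τ p)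
  have := Real.rpow_le_rpow_of_nonpos h0 (hlt.le.trans (le_max_left B 1))
    (by norm_num : (-3 : ℝ) ≤ 0)
  linarith

lemma polePoint_add (τ : ℍ) (p p' : ℤ × ℤ) :
    polePoint τ (p + p') = polePoint τ p + (2 * p'.1 * τ + 2 * p'.2) := by
  simp only [polePoint, Prod.fst_add, Prod.snd_add]
  push_cast
  ring

/-- The sign `(-1)^(m+n)` attached to the pole `(2m+1)τ + 2n`. -/
def poleSign (p : ℤ × ℤ) : ℂ := (-1) ^ (p.1 + p.2)

lemma norm_poleSign (p : ℤ × ℤ) : ‖poleSign p‖ = 1 := by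
  simp [poleSign]

lemma poleSign_add (p p' : ℤ × ℤ) : poleSign (p + p') = poleSign p * poleSign p' := by
  rw [poleSign, poleSign, poleSign, ← zpow_add₀ (by norm_num)]
  congr 1
  simp only [Prod.fst_add, Prod.snd_add]
  ring

/-- Minus a quarter of the second difference of `y ↦ y⁻¹` with step `2`. -/
def invKernel (y : ℂ) : ℂ := (2 * y⁻¹ - (y - 2)⁻¹ - (y + 2)⁻¹) / 4

/-- The leading terms cancel, leaving cubic decay; this makes the regularized series over the poles
absolutely convergent. -/
lemma invKernel_eq {y : ℂ} (h0 : y ≠ 0) (h1 : y - 2 ≠ 0) (h2 : y + 2 ≠ 0) :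
    invKernel y = -2 / (y * (y - 2) * (y + 2)) := by
  rw [invKernel]
  field_simp
  ring

lemma norm_invKernel_le {v w : ℂ} {R : ℝ} (hv : ‖v‖ ≤ R) (hw : 2 * R + 4 ≤ ‖w‖) :
    ‖invKernel (v - w)‖ ≤ 16 * ‖w‖ ^ (-3 : ℝ) := by
  have hR : 0 ≤ R := (norm_nonneg v).trans hv
  have hw0 : 0 < ‖w‖ := by linarith
  -- The bound 2R + 4 keeps each of the three factors of the denominator at least ‖w‖/2, whence the
  -- constant 16 = 2 · 2³.
  have hb : ∀ a : ℂ, ‖a‖ ≤ 2 → ‖w‖ / 2 ≤ ‖v - w + a‖ := fun a ha => by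
    have h1 : ‖w‖ ≤ ‖v - w + a‖ + ‖v‖ + ‖a‖ := by
      calc ‖w‖ = ‖v + a - (v - w + a)‖ := by congr 1; ring
        _ ≤ ‖v + a‖ + ‖v - w + a‖ := norm_sub_le _ _
        _ ≤ _ := by linarith [norm_add_le v a]
    linarith
  have b0 := hb 0 (by simp)
  have b1 := hb (-2) (by simp)
  have b2 := hb 2 (by simp)
  rw [add_zero] at b0
  rw [← sub_eq_add_neg] at b1
  have hpos : 0 < ‖w‖ / 2 := by linarith
  rw [invKernel_eq (norm_pos_iff.mp (hpos.trans_le b0)) (norm_pos_iff.mp (hpos.trans_le b1))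
    (norm_pos_iff.mp (hpos.trans_le b2)), norm_div, norm_mul, norm_mul, norm_neg, Complex.norm_two]
  calc 2 / (‖v - w‖ * ‖v - w - 2‖ * ‖v - w + 2‖) ≤ 2 / (‖w‖ / 2 * (‖w‖ / 2) * (‖w‖ / 2)) := by
        gcongr
    _ = 16 * (‖w‖ ^ 3)⁻¹ := by field_simp; norm_num
    _ = _ := by
        rw [Real.rpow_neg hw0.le]
        norm_cast

lemma eventually_norm_invKernel_le (τ : ℍ) (R : ℝ) : ∀ᶠ p in Filter.cofinite,
    ∀ v ∈ Metric.ball (0 : ℂ) R,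
      ‖poleSign p * invKernel (v - polePoint τ p)‖ ≤ 16 * ‖polePoint τ p‖ ^ (-3 : ℝ) := by
  filter_upwards [eventually_le_norm_polePoint τ (2 * R + 4)] with p hp v hv
  rw [norm_mul, norm_poleSign, one_mul]
  exact norm_invKernel_le (mem_ball_zero_iff.mp hv).le hp

lemma summable_polePoint_bound (τ : ℍ) :
    Summable fun p : ℤ × ℤ => 16 * ‖polePoint τ p‖ ^ (-3 : ℝ) :=
  (summable_norm_polePoint_rpow τ (by norm_num)).mul_left 16

lemma summable_invKernel (τ : ℍ) (v : ℂ) :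
    Summable fun p => poleSign p * invKernel (v - polePoint τ p) := by
  refine (summable_polePoint_bound τ).of_norm_bounded_eventually ?_
  filter_upwards [eventually_norm_invKernel_le τ (‖v‖ + 1)] with p hp
  exact hp v (by simp)

/-- The regularized partial fraction series `∑ (-1)^(m+n) / (v - (2m+1)τ - 2n)`. -/
def poleSum (τ : ℍ) (v : ℂ) : ℂ := ∑' p, poleSign p * invKernel (v - polePoint τ p)

/-- Translation by a period permutes the poles and multiplies every sign by the same factor. -/
lemma poleSum_add (τ : ℍ) (p' : ℤ × ℤ) (v : ℂ) :
    poleSum τ (v + (2 * p'.1 * τ + 2 * p'.2)) = poleSign p' * poleSum τ v := by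
  rw [poleSum, poleSum, ← tsum_mul_left, ← (Equiv.addRight p').tsum_eq]
  refine tsum_congr fun p => ?_
  rw [Equiv.coe_addRight, polePoint_add, poleSign_add, add_sub_add_right_eq_sub]
  ring

lemma poleSum_add_two (τ : ℍ) (v : ℂ) : poleSum τ (v + 2) = -poleSum τ v := by
  simpa [poleSign] using poleSum_add τ (0, 1) v

lemma poleSum_add_two_mul (τ : ℍ) (v : ℂ) : poleSum τ (v + 2 * τ) = -poleSum τ v := by
  simpa [poleSign] using poleSum_add τ (1, 0) v

/-- The Weierstrass test with finitely many exceptions: the exceptional terms are analytic at v₀,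
hence on a smaller neighbourhood. -/
lemma analyticAt_tsum {ι : Type*} {F : ι → ℂ → ℂ} {u : ι → ℝ} (hu : Summable u) {v₀ : ℂ}
    {U : Set ℂ} (hU : U ∈ 𝓝 v₀) (hF : ∀ᶠ i in Filter.cofinite, DifferentiableOn ℂ (F i) U)
    (hFu : ∀ᶠ i in Filter.cofinite, ∀ v ∈ U, ‖F i v‖ ≤ u i) (ha : ∀ i, AnalyticAt ℂ (F i) v₀) :
    AnalyticAt ℂ (fun v => ∑' i, F i v) v₀ := by
  have hfin : {i | ¬ DifferentiableOn ℂ (F i) U}.Finite := hF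
  have h1 : ∀ᶠ v in 𝓝 v₀, ∀ i ∈ {i | ¬ DifferentiableOn ℂ (F i) U}, AnalyticAt ℂ (F i) v :=
    (Filter.eventually_all_finite hfin).mpr fun i _ => (ha i).eventually_analyticAt
  obtain ⟨V, hV, hVo, hvV⟩ := mem_nhds_iff.mp (Filter.inter_mem hU h1)
  have hd : ∀ i, DifferentiableOn ℂ (F i) V := fun i => by
    by_cases hi : DifferentiableOn ℂ (F i) U
    · exact hi.mono fun v hv => (hV hv).1
    · exact fun v hv => ((hV hv).2 i hi).differentiableAt.differentiableWithinAt
  have h2 : TendstoUniformlyOn (fun t v => ∑ i ∈ t, F i v) (fun v => ∑' i, F i v)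
      Filter.atTop V := by
    refine tendstoUniformlyOn_tsum_of_cofinite_eventually hu ?_
    filter_upwards [hFu] with i hi v hv
    exact hi v (hV hv).1
  have h3 := h2.tendstoLocallyUniformlyOn.differentiableOn
    (Filter.Eventually.of_forall fun t => DifferentiableOn.fun_sum fun i _ => hd i) hVo
  exact h3.analyticAt (hVo.mem_nhds hvV)

lemma analyticAt_invKernel {y : ℂ} (h0 : y ≠ 0) (h1 : y - 2 ≠ 0) (h2 : y + 2 ≠ 0) :
    AnalyticAt ℂ invKernel y := by
  have h (a : ℂ) (ha : y + a ≠ 0) : AnalyticAt ℂ (fun y : ℂ => (y + a)⁻¹) y :=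
    (analyticAt_id.add analyticAt_const).inv ha
  have e : invKernel = fun y : ℂ => (2 * (y + 0)⁻¹ - (y + -2)⁻¹ - (y + 2)⁻¹) / 4 := by
    funext y
    rw [invKernel, add_zero, ← sub_eq_add_neg]
  rw [e]
  exact ((((analyticAt_const.mul (h 0 (by rwa [add_zero]))).sub
    (h (-2) (by rwa [← sub_eq_add_neg]))).sub (h 2 h2)).div analyticAt_const (by norm_num))

/-- The term of index p is singular at its pole and at the two translates by ±2, so the terms with
any of these at v₀ must be put in `T`. -/
lemma analyticAt_tsum_invKernel (τ : ℍ) (T : Finset (ℤ × ℤ)) {v₀ : ℂ}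
    (hT : ∀ p ∉ T, v₀ ≠ polePoint τ p ∧ v₀ - 2 ≠ polePoint τ p ∧ v₀ + 2 ≠ polePoint τ p) :
    AnalyticAt ℂ (fun v => ∑' p, if p ∈ T then 0 else
      poleSign p * invKernel (v - polePoint τ p)) v₀ := by
  have hana : ∀ p v, v ≠ polePoint τ p → v - 2 ≠ polePoint τ p → v + 2 ≠ polePoint τ p →
      AnalyticAt ℂ (fun v => if p ∈ T then 0 else
        poleSign p * invKernel (v - polePoint τ p)) v := by
    intro p v h0 h1 h2
    split_ifs
    · exact analyticAt_const
    · refine analyticAt_const.mul (AnalyticAt.fun_comp (analyticAt_invKernel ?_ ?_ ?_)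
        (analyticAt_id.sub analyticAt_const))
      · exact sub_ne_zero.mpr h0
      · simpa [sub_right_comm] using sub_ne_zero.mpr h1
      · simpa [sub_add_eq_add_sub] using sub_ne_zero.mpr h2
  refine analyticAt_tsum (summable_polePoint_bound τ) (U := Metric.ball 0 (‖v₀‖ + 1))
    (Metric.isOpen_ball.mem_nhds (by simp)) ?_ ?_ ?_
  · filter_upwards [eventually_le_norm_polePoint τ (‖v₀‖ + 3)] with p hp v hv
    rw [mem_ball_zero_iff] at hv
    refine (hana p v ?_ ?_ ?_).differentiableAt.differentiableWithinAt <;> intro h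
    · rw [← h] at hp
      linarith
    · rw [← h] at hp
      have := norm_sub_le v 2
      rw [Complex.norm_two] at this
      linarith
    · rw [← h] at hp
      have := norm_add_le v 2
      rw [Complex.norm_two] at this
      linarith
  · filter_upwards [eventually_norm_invKernel_le τ (‖v₀‖ + 1)] with p hp v hv
    split_ifs
    · rw [norm_zero]
      positivity
    · exact hp v hv
  · intro p
    by_cases hp : p ∈ T
    · simp only [hp, if_true]
      exact analyticAt_const
    · exact hana p v₀ (hT p hp).1 (hT p hp).2.1 (hT p hp).2.2

lemma poleSum_analyticAt (τ : ℍ) {v : ℂ} (hv : ∀ p, v ≠ polePoint τ p) :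
    AnalyticAt ℂ (poleSum τ) v := by
  have h := analyticAt_tsum_invKernel τ ∅ (v₀ := v) fun p _ => ⟨hv p, fun h => ?_, fun h => ?_⟩
  · exact h.congr (Filter.Eventually.of_forall fun v => by simp [poleSum])
  · refine hv (p + (0, 1)) ?_
    rw [polePoint_add, ← h]
    simp
  · refine hv (p + (0, -1)) ?_
    rw [polePoint_add, ← h]
    simp

lemma polePoint_injective (τ : ℍ) : Function.Injective (polePoint τ) := by
  intro p p' h
  have him := congrArg Complex.im h
  rw [im_polePoint, im_polePoint, mul_left_inj' τ.im_pos.ne'] at him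
  have h1 : p.1 = p'.1 := by
    have : (p.1 : ℝ) = p'.1 := by linarith
    exact_mod_cast this
  have h2 : p.2 = p'.2 := by
    rw [polePoint, polePoint, h1] at h
    simpa using h
  exact Prod.ext h1 h2

/-- The principal part of the partial fraction series at `τ`. -/
lemma poleSum_principal_part (τ : ℍ) : ∃ h : ℂ → ℂ, AnalyticAt ℂ h τ ∧
    ∀ v, v ≠ (τ : ℂ) → poleSum τ v = 1 / (v - τ) + h v := by
  -- Exactly these three kernels are singular at τ. With their signs, the coefficient of 1/(v - τ)
  -- is 2/4 + 1/4 + 1/4 = 1; the remaining fractions have poles at τ ± 2 and τ ± 4.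
  let T : Finset (ℤ × ℤ) := {(0, 0), (0, 1), (0, -1)}
  have hτ : polePoint τ (0, 0) = τ := by simp [polePoint]
  have hT := analyticAt_tsum_invKernel τ T (v₀ := τ) fun p hp => by
    simp only [T, Finset.mem_insert, Finset.mem_singleton, not_or] at hp
    refine ⟨fun h => hp.1 (polePoint_injective τ ?_), fun h => hp.2.2 (polePoint_injective τ ?_),
      fun h => hp.2.1 (polePoint_injective τ ?_)⟩
    · rw [← h, hτ]
    · rw [← h, polePoint]
      simp [sub_eq_add_neg]
    · rw [← h, polePoint]
      simp
  have hinv (a : ℂ) (ha : a ≠ 0) : AnalyticAt ℂ (fun v : ℂ => (v - τ + a)⁻¹) τ :=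
    ((analyticAt_id.sub analyticAt_const).add analyticAt_const).inv (by simpa using ha)
  refine ⟨fun v => ((v - τ + 4)⁻¹ + (v - τ + -4)⁻¹ - 3 * (v - τ + 2)⁻¹ -
    3 * (v - τ + -2)⁻¹) / 4 + ∑' p, if p ∈ T then 0 else
      poleSign p * invKernel (v - polePoint τ p), ?_, fun v _ => ?_⟩
  · exact (((((hinv 4 (by norm_num)).add (hinv (-4) (by norm_num))).sub
      (analyticAt_const.mul (hinv 2 (by norm_num)))).sub
      (analyticAt_const.mul (hinv (-2) (by norm_num)))).div analyticAt_const (by norm_num)).add hT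
  · have hs := summable_invKernel τ v
    set F : ℤ × ℤ → ℂ := fun p => poleSign p * invKernel (v - polePoint τ p) with hF
    have h1 : ∀ p, F p = (if p ∈ T then F p else 0) + (if p ∈ T then 0 else F p) := fun p => by
      split_ifs <;> simp
    have hs1 : Summable fun p => if p ∈ T then F p else 0 :=
      summable_of_ne_finset_zero (s := T) fun p hp => by simp [hp]
    have hs2 : Summable fun p => if p ∈ T then 0 else F p := by
      refine (hs.sub hs1).congr fun p => ?_
      split_ifs <;> simp
    have h2 : poleSum τ v = ∑ p ∈ T, F p + ∑' p, if p ∈ T then 0 else F p := by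
      rw [poleSum, tsum_congr h1, hs1.tsum_add hs2, tsum_eq_sum (s := T) fun p hp => by simp [hp]]
      congr 1
    rw [h2, ← add_assoc]
    congr 1
    have h01 : ((0, 0) : ℤ × ℤ) ∉ ({(0, 1), (0, -1)} : Finset (ℤ × ℤ)) := by decide
    have h02 : ((0, 1) : ℤ × ℤ) ∉ ({(0, -1)} : Finset (ℤ × ℤ)) := by decide
    simp only [T]
    rw [Finset.sum_insert h01, Finset.sum_insert h02, Finset.sum_singleton]
    simp only [hF, poleSign, polePoint, invKernel]
    push_cast
    rw [show v - ((2 * 0 + 1) * (τ : ℂ) + 2 * 0) = v - τ by ring,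
      show v - ((2 * 0 + 1) * (τ : ℂ) + 2 * 1) = v - τ - 2 by ring,
      show v - ((2 * 0 + 1) * (τ : ℂ) + 2 * -1) = v - τ + 2 by ring]
    generalize v - (τ : ℂ) = y
    rw [show y - 2 - 2 = y + -4 by ring, show y - 2 + 2 = y by ring,
      show y + 2 - 2 = y by ring, show y + 2 + 2 = y + 4 by ring, show y - 2 = y + -2 by ring]
    norm_num
    ring

/-! ### The partial fraction expansion -/

/-- A function with only removable singularities agrees with an entire function. -/
lemma exists_differentiable_of_removable {D : ℂ → ℂ}
    (hD : ∀ v, ∃ g : ℂ → ℂ, AnalyticAt ℂ g v ∧ D =ᶠ[𝓝[≠] v] g) :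
    ∃ E : ℂ → ℂ, Differentiable ℂ E ∧ ∀ v, Filter.Tendsto D (𝓝[≠] v) (𝓝 (E v)) := by
  choose g hg hDg using hD
  have hlim : ∀ v, Filter.Tendsto D (𝓝[≠] v) (𝓝 (g v v)) := fun v =>
    ((hg v).continuousAt.tendsto.mono_left nhdsWithin_le_nhds).congr' (hDg v).symm
  refine ⟨fun v => g v v, fun v => ?_, hlim⟩
  refine (hg v).differentiableAt.congr_of_eventuallyEq ?_
  have h1 := eventually_eventually_nhdsWithin.mpr (hDg v)
  have h2 := (hg v).eventually_analyticAt
  rw [eventually_nhdsWithin_iff] at h1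
  filter_upwards [h1, h2] with v' h1' h2'
  by_cases hv : v' = v
  · rw [hv]
  · have h3 : D =ᶠ[𝓝 v'] g v := by
      have := h1' hv
      rwa [(isOpen_compl_singleton).nhdsWithin_eq hv] at this
    refine tendsto_nhds_unique (hlim v') ?_
    exact (h2'.continuousAt.tendsto.mono_left nhdsWithin_le_nhds).congr'
      (h3.filter_mono nhdsWithin_le_nhds).symm

/-- An entire function which is antiperiodic with respect to `2` and `2τ` vanishes. -/
lemma eq_zero_of_antiperiodic (τ : ℍ) {E : ℂ → ℂ} (hE : Differentiable ℂ E)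
    (h1 : ∀ v, E (v + 2) = -E v) (h2 : ∀ v, E (v + 2 * τ) = -E v) (v : ℂ) : E v = 0 := by
  -- The norm of E is doubly periodic, and the closed ball below contains a fundamental
  -- parallelogram. So E is bounded, hence constant by Liouville, and antiperiodicity leaves only 0.
  have p1 : Function.Periodic (fun v => ‖E v‖) 2 := fun v => by simp [h1]
  have p2 : Function.Periodic (fun v => ‖E v‖) (2 * τ) := fun v => by simp [h2]
  obtain ⟨M, hM⟩ := (isCompact_closedBall (0 : ℂ) (2 + 2 * τ.im)).exists_bound_of_continuousOn
    hE.continuous.continuousOn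
  have hb : Bornology.IsBounded (Set.range E) := by
    refine isBounded_iff_forall_norm_le.mpr ⟨M, ?_⟩
    rintro _ ⟨v, rfl⟩
    have hτ := τ.im_pos
    set b : ℤ := ⌊v.im / (2 * τ.im)⌋ with hb
    set v₁ : ℂ := v - b * (2 * τ) with hv₁
    set a : ℤ := ⌊v₁.re / 2⌋ with ha
    set v₂ : ℂ := v₁ - a * 2 with hv₂
    have e1 : ‖E v₂‖ = ‖E v‖ := by
      rw [hv₂, (p1.int_mul a).sub_eq (x := v₁), hv₁, (p2.int_mul b).sub_eq (x := v)]
    rw [← e1]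
    refine hM v₂ (mem_closedBall_zero_iff.mpr ?_)
    have i1 : v₂.im = v.im - b * (2 * τ.im) := by
      simp [hv₂, hv₁]
    have i2 : v₂.re = v₁.re - a * 2 := by
      simp [hv₂]
    have f1 := Int.floor_le (v.im / (2 * τ.im))
    have f2 := Int.lt_floor_add_one (v.im / (2 * τ.im))
    have f3 := Int.floor_le (v₁.re / 2)
    have f4 := Int.lt_floor_add_one (v₁.re / 2)
    rw [← hb, le_div_iff₀ (by positivity)] at f1
    rw [← hb, div_lt_iff₀ (by positivity)] at f2
    rw [← ha] at f3 f4
    have g1 : |v₂.im| ≤ 2 * τ.im := by rw [i1, abs_le]; constructor <;> linarith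
    have g2 : |v₂.re| ≤ 2 := by rw [i2, abs_le]; constructor <;> linarith
    linarith [Complex.norm_le_abs_re_add_abs_im v₂]
  have h3 := hE.apply_eq_apply_of_bounded hb (v + 2) v
  rw [h1] at h3
  exact self_eq_neg.mp h3.symm

/-- Antiperiodicity moves any pole to τ, where the two principal parts cancel. The equality is on a
punctured neighbourhood because the value assigned at a pole is arbitrary. -/
lemma exists_analyticAt_cnNormalized_sub (τ : ℍ) (v : ℂ) : ∃ g : ℂ → ℂ, AnalyticAt ℂ g v ∧
    (fun v => cnNormalized τ v - cnResidue τ * poleSum τ v) =ᶠ[𝓝[≠] v] g := by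
  by_cases hv : ∀ p, v ≠ polePoint τ p
  · exact ⟨_, (cnNormalized_analyticAt τ hv).sub
      (analyticAt_const.mul (poleSum_analyticAt τ hv)), Filter.EventuallyEq.rfl⟩
  · push Not at hv
    obtain ⟨p, rfl⟩ := hv
    obtain ⟨h₁, ha₁, he₁⟩ := cnNormalized_principal_part τ
    obtain ⟨h₂, ha₂, he₂⟩ := poleSum_principal_part τ
    have a1 : Function.Antiperiodic
        (fun v => cnNormalized τ v - cnResidue τ * poleSum τ v) 2 := fun v => by
      simp only [cnNormalized_add_two, poleSum_add_two]
      ring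
    have a2 : Function.Antiperiodic
        (fun v => cnNormalized τ v - cnResidue τ * poleSum τ v) (2 * τ) := fun v => by
      simp only [cnNormalized_add_two_mul, poleSum_add_two_mul]
      ring
    set D := fun v => cnNormalized τ v - cnResidue τ * poleSum τ v with hD
    have hper : ∀ v, D v = ((p.2.negOnePow : ℤ) : ℂ) * (((p.1.negOnePow : ℤ) : ℂ) *
        D (v - (p.1 * (2 * τ) + p.2 * 2))) := fun v => by
      rw [← a2.add_int_mul_eq, ← a1.add_int_mul_eq]
      congr 1
      ring
    refine ⟨fun v => ((p.2.negOnePow : ℤ) : ℂ) * (((p.1.negOnePow : ℤ) : ℂ) *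
      (h₁ (v - (p.1 * (2 * τ) + p.2 * 2)) - cnResidue τ *
        h₂ (v - (p.1 * (2 * τ) + p.2 * 2)))), ?_, ?_⟩
    · have e : polePoint τ p - (p.1 * (2 * τ) + p.2 * 2) = τ := by
        rw [polePoint]
        ring
      have hs : AnalyticAt ℂ (fun v : ℂ => v - (p.1 * (2 * τ) + p.2 * 2)) (polePoint τ p) :=
        analyticAt_id.sub analyticAt_const
      exact analyticAt_const.mul (analyticAt_const.mul
        ((AnalyticAt.fun_comp (by rwa [e]) hs).sub
          (analyticAt_const.mul (AnalyticAt.fun_comp (by rwa [e]) hs))))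
    · filter_upwards [self_mem_nhdsWithin] with v hv
      have hv' : v - (p.1 * (2 * τ) + p.2 * 2) ≠ τ := fun h => hv <| by
        rw [Set.mem_singleton_iff, polePoint, ← sub_eq_zero]
        rw [← sub_eq_zero] at h
        linear_combination h
      rw [hper]
      simp only [hD]
      rw [he₁ _ hv', he₂ _ hv']
      ring

/-- The partial fraction expansion of `v ↦ cn(K v)`. -/
theorem cnNormalized_eq_poleSum (τ : ℍ) {v : ℂ} (hv : ∀ p, v ≠ polePoint τ p) :
    cnNormalized τ v = cnResidue τ * poleSum τ v := by
  obtain ⟨E, hE, hlim⟩ :=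
    exists_differentiable_of_removable (exists_analyticAt_cnNormalized_sub τ)
  -- E is a punctured limit of the difference, so it inherits both antiperiods.
  have hshift : ∀ a : ℂ, (∀ v, cnNormalized τ (v + a) - cnResidue τ * poleSum τ (v + a) =
      -(cnNormalized τ v - cnResidue τ * poleSum τ v)) → ∀ v, E (v + a) = -E v := by
    intro a ha v
    have h1 : Filter.Tendsto (fun v => v + a) (𝓝[≠] v) (𝓝[≠] (v + a)) :=
      tendsto_nhdsWithin_of_tendsto_nhds_of_eventually_within _
        ((continuous_add_const a).continuousAt.tendsto.mono_left nhdsWithin_le_nhds)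
        (by filter_upwards [self_mem_nhdsWithin] with x hx using fun h => hx (add_right_cancel h))
    exact tendsto_nhds_unique ((hlim (v + a)).comp h1)
      ((hlim v).neg.congr fun x => (ha x).symm)
  have h0 := eq_zero_of_antiperiodic τ hE
    (hshift 2 fun v => by rw [cnNormalized_add_two, poleSum_add_two]; ring)
    (hshift (2 * τ) fun v => by rw [cnNormalized_add_two_mul, poleSum_add_two_mul]; ring) v
  have h1 := ((cnNormalized_analyticAt τ hv).continuousAt.tendsto.sub
    ((poleSum_analyticAt τ hv).continuousAt.tendsto.const_mul (cnResidue τ))).mono_left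
      (nhdsWithin_le_nhds (s := {v}ᶜ))
  have h2 := tendsto_nhds_unique (hlim v) h1
  rw [h0] at h2
  exact (sub_eq_zero.mp h2.symm)

/-! ### The Taylor expansion at the origin -/

/-- Minus a quarter of the second difference of `φ` with step `2`. -/
def negSecondDiff (φ : ℂ → ℂ) (w : ℂ) : ℂ := (2 * φ w - φ (w - 2) - φ (w + 2)) / 4

/-- Passing to the second difference does not change the sum of a summable series. -/
lemma tsum_negSecondDiff (τ : ℍ) {φ : ℂ → ℂ}
    (hφ : Summable fun p => poleSign p * φ (polePoint τ p)) :
    ∑' p, poleSign p * negSecondDiff φ (polePoint τ p) =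
      ∑' p, poleSign p * φ (polePoint τ p) := by
  have s1 : poleSign (0, 1) = -1 := by simp [poleSign]
  have s2 : poleSign (0, -1) = -1 := by simp [poleSign]
  have h1 : HasSum (fun p => -(poleSign p * φ (polePoint τ p + 2))) _ :=
    ((Equiv.addRight ((0, 1) : ℤ × ℤ)).hasSum_iff.mpr hφ.hasSum).congr_fun fun p => by
      simp [polePoint_add, poleSign_add, s1]
  have h2 : HasSum (fun p => -(poleSign p * φ (polePoint τ p - 2))) _ :=
    ((Equiv.addRight ((0, -1) : ℤ × ℤ)).hasSum_iff.mpr hφ.hasSum).congr_fun fun p => by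
      simp [polePoint_add, poleSign_add, s2, sub_eq_add_neg]
  have h3 := (((hφ.hasSum.mul_left 2).add h2).add h1).div_const 4
  have h4 : HasSum (fun p => poleSign p * negSecondDiff φ (polePoint τ p)) _ :=
    h3.congr_fun fun p => by
      rw [negSecondDiff]
      ring
  rw [h4.tsum_eq]
  ring

/-- The regularized sum of the `-(2k+1)`-st powers of the poles. -/
def oddPoleSum (τ : ℍ) (k : ℕ) : ℂ :=
  ∑' p, poleSign p * negSecondDiff (fun w => (w ^ (2 * k + 1))⁻¹) (polePoint τ p)

/-- Geometric series for 1/(v - w) and 1/(-v - w): the odd powers of v cancel. -/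
lemma hasSum_inv_add_inv {v w : ℂ} (h : ‖v‖ < ‖w‖) :
    HasSum (fun k : ℕ => -2 * (w ^ (2 * k + 1))⁻¹ * v ^ (2 * k)) ((v - w)⁻¹ + (-v - w)⁻¹) := by
  have hw : w ≠ 0 := norm_pos_iff.mp ((norm_nonneg v).trans_lt h)
  have h1 : ‖v / w‖ < 1 := by rwa [norm_div, div_lt_one (norm_pos_iff.mpr hw)]
  have h2 := (hasSum_geometric_of_norm_lt_one (norm_sq_lt_one h1)).mul_left (-2 * w⁻¹)
  have n1 : v - w ≠ 0 := sub_ne_zero.mpr fun e => by simp [e] at h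
  have n2 : v + w ≠ 0 := fun e => by simp [eq_neg_of_add_eq_zero_left e] at h
  have n3 : w ^ 2 - v ^ 2 ≠ 0 := by
    rw [show w ^ 2 - v ^ 2 = -((v - w) * (v + w)) by ring]
    exact neg_ne_zero.mpr (mul_ne_zero n1 n2)
  convert! h2 using 1
  · funext k
    rw [← pow_mul, div_pow, pow_succ]
    field_simp
  · have n4 : -v - w ≠ 0 := by
      rw [← neg_add']
      exact neg_ne_zero.mpr n2
    rw [div_pow, one_sub_div (pow_ne_zero 2 hw), inv_div]
    field_simp
    ring

/-- A summable bound for the terms of the expansion. -/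
def poleBound (τ : ℍ) (p : ℤ × ℤ) : ℝ :=
  (‖polePoint τ p‖ ^ 3)⁻¹ + (‖polePoint τ p - 2‖ ^ 3)⁻¹ + (‖polePoint τ p + 2‖ ^ 3)⁻¹

lemma polePoint_sub_two (τ : ℍ) (p : ℤ × ℤ) :
    polePoint τ p - 2 = polePoint τ (p + (0, -1)) := by
  simp [polePoint_add, sub_eq_add_neg]

lemma polePoint_add_two (τ : ℍ) (p : ℤ × ℤ) : polePoint τ p + 2 = polePoint τ (p + (0, 1)) := by
  simp [polePoint_add]

lemma summable_poleBound (τ : ℍ) : Summable (poleBound τ) := by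
  have h : Summable fun p => (‖polePoint τ p‖ ^ 3)⁻¹ :=
    (summable_norm_polePoint_rpow τ (k := 3) (by norm_num)).congr fun p => by
      rw [Real.rpow_neg (norm_nonneg _)]
      norm_cast
  have h1 := (Equiv.addRight ((0, -1) : ℤ × ℤ)).summable_iff.mpr h
  have h2 := (Equiv.addRight ((0, 1) : ℤ × ℤ)).summable_iff.mpr h
  refine ((h.add h1).add h2).congr fun p => ?_
  simp [poleBound, polePoint_sub_two, polePoint_add_two]

/-- For k ≥ 1 the exponent is at least 3, and each of the three terms is bounded on its own, the
excess powers by Im τ. For k = 0 the cancellation of the second difference is needed. The 1 in 1 +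
(Im τ)² serves k = 0, the (Im τ)² serves k ≥ 1. -/
lemma norm_negSecondDiff_le (τ : ℍ) (p : ℤ × ℤ) (k : ℕ) {r : ℝ} (hr : 0 ≤ r) :
    ‖negSecondDiff (fun w => (w ^ (2 * k + 1))⁻¹) (polePoint τ p)‖ * r ^ (2 * k) ≤
      poleBound τ p * ((1 + τ.im ^ 2) * ((r / τ.im) ^ 2) ^ k) := by
  have hρ := τ.im_pos
  have l0 := im_le_norm_polePoint τ p
  have l1 := im_le_norm_polePoint τ (p + (0, -1))
  have l2 := im_le_norm_polePoint τ (p + (0, 1))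
  have n0 := polePoint_ne_zero τ p
  have n1 := polePoint_ne_zero τ (p + (0, -1))
  have n2 := polePoint_ne_zero τ (p + (0, 1))
  rw [← polePoint_sub_two] at l1 n1
  rw [← polePoint_add_two] at l2 n2
  rw [poleBound]
  generalize polePoint τ p = w at *
  have p0 := norm_pos_iff.mpr n0
  have p1 := norm_pos_iff.mpr n1
  have p2 := norm_pos_iff.mpr n2
  rcases Nat.eq_zero_or_pos k with rfl | hk
  · have e : negSecondDiff (fun w => (w ^ (2 * 0 + 1))⁻¹) w = -2 / (w * (w - 2) * (w + 2)) := by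
      rw [← invKernel_eq n0 n1 n2]
      simp [negSecondDiff, invKernel]
    rw [e]
    simp only [mul_zero, pow_zero, mul_one, norm_div, norm_mul, norm_neg, Complex.norm_two]
    have a0 := inv_pos.mpr p0
    have a1 := inv_pos.mpr p1
    have a2 := inv_pos.mpr p2
    rw [div_eq_mul_inv, mul_inv, mul_inv]
    simp only [← inv_pow]
    generalize ‖w‖⁻¹ = a at *
    generalize ‖w - 2‖⁻¹ = b at *
    generalize ‖w + 2‖⁻¹ = c at *
    -- The inequality of arithmetic and geometric means for a³, b³, c³.
    have h3 : 2 * (a * b * c) ≤ a ^ 3 + b ^ 3 + c ^ 3 := by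
      nlinarith [mul_nonneg (add_nonneg (add_nonneg a0.le a1.le) a2.le)
        (add_nonneg (add_nonneg (sq_nonneg (a - b)) (sq_nonneg (b - c))) (sq_nonneg (a - c))),
        mul_pos (mul_pos a0 a1) a2]
    have h4 : 0 ≤ a ^ 3 + b ^ 3 + c ^ 3 := by positivity
    nlinarith [mul_nonneg h4 (sq_nonneg τ.im)]
  · obtain ⟨j, rfl⟩ : ∃ j, k = j + 1 := ⟨k - 1, by lia⟩
    have hb : ∀ x : ℝ, τ.im ≤ x → (x ^ (2 * (j + 1) + 1))⁻¹ ≤ (x ^ 3)⁻¹ * (τ.im ^ (2 * j))⁻¹ := by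
      intro x hx
      have hx0 : 0 < x := hρ.trans_le hx
      rw [← mul_inv, show 2 * (j + 1) + 1 = 3 + 2 * j by ring, pow_add]
      gcongr
    have h1 : ‖negSecondDiff (fun w => (w ^ (2 * (j + 1) + 1))⁻¹) w‖ ≤
        ((‖w‖ ^ 3)⁻¹ + (‖w - 2‖ ^ 3)⁻¹ + (‖w + 2‖ ^ 3)⁻¹) * (τ.im ^ (2 * j))⁻¹ := by
      rw [negSecondDiff, norm_div]
      have t1 := norm_sub_le (2 * (w ^ (2 * (j + 1) + 1))⁻¹ - ((w - 2) ^ (2 * (j + 1) + 1))⁻¹)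
        ((w + 2) ^ (2 * (j + 1) + 1))⁻¹
      have t2 := norm_sub_le (2 * (w ^ (2 * (j + 1) + 1))⁻¹) ((w - 2) ^ (2 * (j + 1) + 1))⁻¹
      simp only [norm_mul, norm_inv, norm_pow, Complex.norm_two] at t1 t2
      have b0 := hb _ l0
      have b1 := hb _ l1
      have b2 := hb _ l2
      have c1 : 0 ≤ (‖w - 2‖ ^ 3)⁻¹ * (τ.im ^ (2 * j))⁻¹ := by positivity
      have c2 : 0 ≤ (‖w + 2‖ ^ 3)⁻¹ * (τ.im ^ (2 * j))⁻¹ := by positivity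
      have c0 : 0 ≤ (‖w‖ ^ 3)⁻¹ * (τ.im ^ (2 * j))⁻¹ := by positivity
      rw [show ‖(4 : ℂ)‖ = 4 by norm_num, div_le_iff₀ (by norm_num)]
      linarith
    refine (mul_le_mul_of_nonneg_right h1 (by positivity)).trans ?_
    rw [mul_assoc]
    refine mul_le_mul_of_nonneg_left ?_ (by positivity)
    have h2 : (τ.im ^ (2 * j))⁻¹ * r ^ (2 * (j + 1)) = τ.im ^ 2 * ((r / τ.im) ^ 2) ^ (j + 1) := by
      rw [← pow_mul, div_pow]
      field_simp
      ring
    rw [h2]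
    gcongr
    linarith

/-- As cn is even, it is half the sum of its partial fractions at v and -v. Expanding each term
geometrically gives an absolutely convergent double series, which is summed in both orders. -/
theorem hasSum_cnNormalized (τ : ℍ) {v : ℂ} (hv : ‖v‖ < τ.im) :
    HasSum (fun k : ℕ => -cnResidue τ * oddPoleSum τ k * v ^ (2 * k)) (cnNormalized τ v) := by
  set φ : ℕ → ℂ → ℂ := fun k w => (w ^ (2 * k + 1))⁻¹ with hφ
  let F : (ℤ × ℤ) × ℕ → ℂ := fun x =>
    poleSign x.1 * (-2 * negSecondDiff (φ x.2) (polePoint τ x.1) * v ^ (2 * x.2))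
  have hr : ‖v‖ / τ.im < 1 := (div_lt_one τ.im_pos).mpr hv
  have hr0 : 0 ≤ ‖v‖ / τ.im := div_nonneg (norm_nonneg v) τ.im_pos.le
  have hF : Summable F := by
    have hg : Summable fun k : ℕ => (1 + τ.im ^ 2) * ((‖v‖ / τ.im) ^ 2) ^ k :=
      (summable_geometric_of_lt_one (by positivity)
        (pow_lt_one₀ hr0 hr two_ne_zero)).mul_left _
    have hB := ((summable_poleBound τ).mul_of_nonneg hg
      (fun p => by simp only [poleBound, Pi.zero_apply]; positivity)
      (fun k => by simp only [Pi.zero_apply]; positivity)).mul_left 2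
    refine hB.of_norm_bounded fun x => ?_
    have := norm_negSecondDiff_le τ x.1 x.2 (norm_nonneg v)
    simp only [F, norm_mul, norm_poleSign, norm_neg, Complex.norm_two, norm_pow, one_mul]
    rw [mul_assoc]
    exact mul_le_mul_of_nonneg_left this two_pos.le
  have hfib : ∀ p, HasSum (fun k => F (p, k)) (poleSign p *
      (invKernel (v - polePoint τ p) + invKernel (-v - polePoint τ p))) := by
    intro p
    have h0 := hasSum_inv_add_inv (hv.trans_le (im_le_norm_polePoint τ p))
    have h1 := hasSum_inv_add_inv (hv.trans_le (im_le_norm_polePoint τ (p + (0, -1))))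
    have h2 := hasSum_inv_add_inv (hv.trans_le (im_le_norm_polePoint τ (p + (0, 1))))
    rw [← polePoint_sub_two] at h1
    rw [← polePoint_add_two] at h2
    have h3 := ((((h0.mul_left 2).sub h1).sub h2).div_const 4).mul_left (poleSign p)
    convert! h3 using 1
    · funext k
      simp only [F, hφ, negSecondDiff]
      ring
    · simp only [invKernel]
      generalize polePoint τ p = w
      rw [show v - w - 2 = v - (w + 2) by ring, show v - w + 2 = v - (w - 2) by ring,
        show -v - w - 2 = -v - (w + 2) by ring, show -v - w + 2 = -v - (w - 2) by ring]
      ring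
  have hS := hF.hasSum.prod_fiberwise hfib
  have hS' : HasSum (fun p => poleSign p *
      (invKernel (v - polePoint τ p) + invKernel (-v - polePoint τ p)))
      (poleSum τ v + poleSum τ (-v)) :=
    ((summable_invKernel τ v).hasSum.add (summable_invKernel τ (-v)).hasSum).congr_fun
      fun p => by ring
  have hval := hS.unique hS'
  have hfib2 : ∀ k, HasSum (fun p => F (p, k)) (-2 * oddPoleSum τ k * v ^ (2 * k)) := by
    intro k
    have h1 : Summable fun p => F (p, k) :=
      hF.comp_injective (i := fun p => (p, k)) fun a b h => congrArg Prod.fst h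
    convert! h1.hasSum using 1
    rw [oddPoleSum, mul_right_comm, ← tsum_mul_left]
    refine tsum_congr fun p => ?_
    simp only [F, hφ]
    ring
  have hT := (hF.prod_symm.hasSum.prod_fiberwise (fun k => hfib2 k)).mul_left (cnResidue τ / 2)
  have htot : ∑' x : ℕ × (ℤ × ℤ), F x.swap = poleSum τ v + poleSum τ (-v) := by
    rw [← hval]
    exact (Equiv.prodComm ℕ (ℤ × ℤ)).tsum_eq F
  rw [htot] at hT
  have hnp : ∀ x : ℂ, ‖x‖ < τ.im → ∀ p, x ≠ polePoint τ p := fun x hx p h => by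
    have := im_le_norm_polePoint τ p
    rw [← h] at this
    linarith
  convert! hT using 1
  · funext k
    ring
  · have e1 := cnNormalized_eq_poleSum τ (hnp v hv)
    have e2 := cnNormalized_eq_poleSum τ (hnp (-v) (by rwa [norm_neg]))
    rw [cnNormalized_neg] at e2
    linear_combination (e1 + e2) / 2

/-! ### The values `L(2k+1, χ₄)` -/

/-- The nontrivial character modulo `4`, with complex values. -/
def chiFour : DirichletCharacter ℂ 4 := ZMod.χ₄.ringHomComp (Int.castRingHom ℂ)

lemma chiFour_apply (a : ZMod 4) : chiFour a = (ZMod.χ₄ a : ℂ) := rfl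

lemma chiFour_ne_one : chiFour ≠ 1 := by
  intro h
  have h1 : chiFour (3 : ZMod 4) = 1 := by
    rw [h]
    exact MulChar.one_apply (by decide)
  rw [chiFour_apply, show ZMod.χ₄ 3 = -1 from rfl] at h1
  norm_num at h1

/-- This identifies L(s,χ₄) with the sine zeta function at 1/4, whose values at odd integers are
given by Bernoulli polynomials. -/
lemma sin_two_pi_quarter_mul (n : ℕ) :
    Real.sin (2 * π * (1 / 4 : ℝ) * n) = (ZMod.χ₄ (n : ZMod 4) : ℝ) := by
  have h4 : Real.sin (2 * π * (1 / 4 : ℝ) * n) =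
      Real.sin (2 * π * (1 / 4 : ℝ) * ((n % 4 : ℕ) : ℝ)) := by
    conv_lhs => rw [← Nat.mod_add_div n 4]
    push_cast
    rw [show 2 * π * (1 / 4) * (((n % 4 : ℕ) : ℝ) + 4 * ((n / 4 : ℕ) : ℝ)) =
      2 * π * (1 / 4) * ((n % 4 : ℕ) : ℝ) + ((n / 4 : ℕ) : ℝ) * (2 * π) by ring,
      Real.sin_add_nat_mul_two_pi]
  rw [h4, ZMod.χ₄_nat_mod_four]
  have hn : n % 4 < 4 := Nat.mod_lt _ (by norm_num)
  interval_cases n % 4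
  · simp
  · rw [show 2 * π * (1 / 4) * ((1 : ℕ) : ℝ) = π / 2 by push_cast; ring, Real.sin_pi_div_two]
    simp [show ZMod.χ₄ 1 = 1 from rfl]
  · rw [show 2 * π * (1 / 4) * ((2 : ℕ) : ℝ) = π by push_cast; ring, Real.sin_pi]
    simp [show ZMod.χ₄ 2 = 0 from rfl]
  · rw [show 2 * π * (1 / 4) * ((3 : ℕ) : ℝ) = π / 2 + π by push_cast; ring, Real.sin_add_pi,
      Real.sin_pi_div_two]
    simp [show ZMod.χ₄ 3 = -1 from rfl]

lemma hasSum_LFunction_chiFour {s : ℂ} (hs : 1 < s.re) :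
    HasSum (fun n : ℕ => (ZMod.χ₄ (n : ZMod 4) : ℂ) / (n : ℂ) ^ s)
      (DirichletCharacter.LFunction chiFour s) := by
  rw [DirichletCharacter.LFunction_eq_LSeries chiFour hs]
  have h := (DirichletCharacter.LSeriesSummable_of_one_lt_re chiFour hs).LSeriesHasSum
  refine HasSum.congr_fun h fun n => ?_
  rcases eq_or_ne n 0 with rfl | hn
  · simp
  · rw [LSeries.term_of_ne_zero hn, chiFour_apply]

lemma LFunction_chiFour_eq_sinZeta {s : ℂ} (hs : 1 < s.re) :
    DirichletCharacter.LFunction chiFour s = HurwitzZeta.sinZeta ((1 / 4 : ℝ) : UnitAddCircle) s := by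
  refine (hasSum_LFunction_chiFour hs).unique
    ((HurwitzZeta.hasSum_nat_sinZeta (1 / 4) hs).congr_fun fun n => ?_)
  rw [sin_two_pi_quarter_mul]
  push_cast
  rfl

lemma hasSum_pairs {b : ℕ → ℂ} {l : ℂ} (hb : HasSum b l) :
    HasSum (fun j => b (2 * j) + b (2 * j + 1)) l := by
  have s1 : Summable fun j => b (2 * j) :=
    hb.summable.comp_injective (i := fun j : ℕ => 2 * j) fun m n h => by simpa using h
  have s2 : Summable fun j => b (2 * j + 1) :=
    hb.summable.comp_injective (i := fun j : ℕ => 2 * j + 1) fun m n h => by simpa using h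
  rw [← hb.tsum_eq, ← tsum_even_add_odd s1 s2]
  exact s1.hasSum.add s2.hasSum

/-- Pairing consecutive odd terms yields a series dominated uniformly as x → 1⁺, which the original
series is not. -/
lemma hasSum_LFunction_chiFour_alternating {x : ℝ} (hx : 1 < x) :
    HasSum (fun j : ℕ => (((4 * j + 1 : ℝ) ^ (-x) - (4 * j + 3 : ℝ) ^ (-x) : ℝ) : ℂ))
      (DirichletCharacter.LFunction chiFour x) := by
  have h := hasSum_LFunction_chiFour (s := x) (by simpa using hx)
  obtain ⟨c, hc⟩ : ∃ c : ℕ → ℤ, ∀ n : ℕ, ZMod.χ₄ (n : ZMod 4) = c n := ⟨_, fun n => rfl⟩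
  have hc' := fun n : ℕ => (hc n).symm.trans (ZMod.χ₄_nat_eq_if_mod_four n)
  simp only [hc] at h
  clear hc
  set a : ℕ → ℂ := fun n => (c n : ℂ) / (n : ℂ) ^ (x : ℂ) with ha
  have hodd : HasSum (fun n : ℕ => a (2 * n + 1)) (DirichletCharacter.LFunction chiFour x) := by
    have hinj : Function.Injective fun n : ℕ => 2 * n + 1 := fun m n h => by
      simpa using h
    refine (hinj.hasSum_iff fun n hn => ?_).mpr h
    have : n % 2 = 0 := by
      by_contra h2
      exact hn ⟨n / 2, by simp only; lia⟩
    simp only [ha]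
    rw [hc', if_pos this, Int.cast_zero, zero_div]
  have h3 := hasSum_pairs hodd
  refine h3.congr_fun fun j => ?_
  have c1 : c (2 * (2 * j) + 1) = 1 := by
    rw [hc', if_neg (by lia), if_pos (by lia)]
  have c2 : c (2 * (2 * j + 1) + 1) = -1 := by
    rw [hc', if_neg (by lia), if_neg (by lia)]
  simp only [ha, c1, c2]
  have p1 : (0 : ℝ) ≤ 4 * j + 1 := by positivity
  have p2 : (0 : ℝ) ≤ 4 * j + 3 := by positivity
  rw [Complex.ofReal_sub, Complex.ofReal_cpow p1, Complex.ofReal_cpow p2, Complex.ofReal_neg,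
    Complex.cpow_neg, Complex.cpow_neg]
  push_cast
  rw [show (2 * (2 * (j : ℂ)) + 1) = 4 * j + 1 by ring,
    show (2 * (2 * (j : ℂ) + 1) + 1) = 4 * j + 3 by ring]
  ring

lemma norm_rpow_neg_sub_le {a b x : ℝ} (ha : 1 ≤ a) (hab : a ≤ b) (hx1 : 1 ≤ x) (hx2 : x ≤ 2) :
    ‖a ^ (-x) - b ^ (-x)‖ ≤ 2 * (b - a) / (a * b) := by
  have ha0 : 0 < a := by linarith
  have hb0 : 0 < b := by linarith
  have h1 : a ^ (-x) - b ^ (-x) = a ^ (-x) * (1 - (a / b) ^ x) := by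
    rw [Real.div_rpow ha0.le hb0.le, Real.rpow_neg ha0.le, Real.rpow_neg hb0.le]
    have := (Real.rpow_pos_of_pos ha0 x).ne'
    field_simp
  have hr0 : 0 < a / b := div_pos ha0 hb0
  have hr1 : a / b ≤ 1 := (div_le_one hb0).mpr hab
  have h2 : (a / b) ^ (2 : ℝ) ≤ (a / b) ^ x := Real.rpow_le_rpow_of_exponent_ge hr0 hr1 hx2
  have h3 : (a / b) ^ x ≤ 1 := Real.rpow_le_one hr0.le hr1 (by linarith)
  have h4 : a ^ (-x) ≤ a⁻¹ := by
    rw [← Real.rpow_neg_one]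
    exact Real.rpow_le_rpow_of_exponent_le ha (by linarith)
  rw [Real.rpow_two] at h2
  -- For t = a/b ≤ 1 one has 1 - t^x ≤ 1 - t² ≤ 2(1 - t).
  have h5 : 1 - (a / b) ^ x ≤ 2 * (1 - a / b) := by nlinarith [sq_nonneg (1 - a / b)]
  rw [h1, Real.norm_of_nonneg (mul_nonneg (by positivity) (by linarith))]
  calc a ^ (-x) * (1 - (a / b) ^ x) ≤ a⁻¹ * (2 * (1 - a / b)) := by gcongr
    _ = _ := by field_simp

/-- The L-function is continuous at 1, and by dominated convergence the paired series tends to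
Leibniz's series for π/4. The sine zeta formula used in `LFunction_chiFour_odd` covers only k ≥ 1.
-/
lemma LFunction_chiFour_one : DirichletCharacter.LFunction chiFour 1 = π / 4 := by
  set f : ℝ → ℕ → ℝ := fun x j => (4 * j + 1 : ℝ) ^ (-x) - (4 * j + 3 : ℝ) ^ (-x) with hf
  have hbound : ∀ x ∈ Set.Icc (1 : ℝ) 2, ∀ j, ‖f x j‖ ≤ 4 * (1 / ((j : ℝ) + 1) ^ 2) := by
    intro x hx j
    refine (norm_rpow_neg_sub_le (by linarith [(Nat.cast_nonneg j : (0 : ℝ) ≤ j)])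
      (by linarith) hx.1 hx.2).trans ?_
    rw [mul_one_div, show 2 * (4 * (j : ℝ) + 3 - (4 * j + 1)) = 4 by ring]
    refine div_le_div_of_nonneg_left (by norm_num) (by positivity) ?_
    nlinarith [(Nat.cast_nonneg j : (0 : ℝ) ≤ j)]
  have hsum : Summable fun j : ℕ => 4 * (1 / ((j : ℝ) + 1) ^ 2) := by
    have h := (summable_nat_add_iff 1).mpr (Real.summable_one_div_nat_pow.mpr one_lt_two)
    exact (by simpa using h : Summable fun j : ℕ => 1 / ((j : ℝ) + 1) ^ 2).mul_left 4
  have hS1 : Summable (f 1) := hsum.of_norm_bounded (hbound 1 (by norm_num))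
  have hval : ∑' j, f 1 j = π / 4 := by
    have h1 := Real.tendsto_sum_pi_div_four.comp
      (Filter.tendsto_id.const_mul_atTop' (two_pos : 0 < 2))
    refine tendsto_nhds_unique hS1.hasSum.tendsto_sum_nat (h1.congr fun n => ?_)
    simp only [Function.comp_apply, id]
    induction n with
    | zero => simp
    | succ n ih =>
      rw [show 2 * (n + 1) = 2 * n + 1 + 1 by ring, Finset.sum_range_succ, Finset.sum_range_succ,
        ih, Finset.sum_range_succ, add_assoc]
      congr 1
      simp only [hf, Real.rpow_neg_one, pow_succ, pow_mul]
      push_cast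
      norm_num
      ring
  have hlim : Filter.Tendsto (fun x => ∑' j, f x j) (𝓝[>] 1) (𝓝 (∑' j, f 1 j)) := by
    refine tendsto_tsum_of_dominated_convergence hsum (fun j => ?_) ?_
    · have c : ∀ a : ℝ, 0 < a → Continuous fun x : ℝ => a ^ (-x) := fun a ha =>
        Continuous.rpow continuous_const continuous_neg fun x => Or.inl ha.ne'
      exact (((c _ (by positivity)).sub (c _ (by positivity))).tendsto 1).mono_left
        nhdsWithin_le_nhds
    · filter_upwards [Ioc_mem_nhdsGT (one_lt_two : (1 : ℝ) < 2)] with x hx j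
      exact hbound x ⟨hx.1.le, hx.2⟩ j
  have hL : Filter.Tendsto (fun x : ℝ => DirichletCharacter.LFunction chiFour x) (𝓝[>] 1)
      (𝓝 (DirichletCharacter.LFunction chiFour (1 : ℝ))) :=
    (((DirichletCharacter.differentiable_LFunction chiFour_ne_one).continuous.comp
      Complex.continuous_ofReal).tendsto 1).mono_left nhdsWithin_le_nhds
  have h2 : Filter.Tendsto (fun x : ℝ => DirichletCharacter.LFunction chiFour x) (𝓝[>] 1)
      (𝓝 ((∑' j, f 1 j : ℝ) : ℂ)) := by
    refine ((Complex.continuous_ofReal.tendsto _).comp hlim).congr' ?_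
    filter_upwards [self_mem_nhdsWithin] with x hx
    rw [Function.comp_apply, Complex.ofReal_tsum]
    exact (hasSum_LFunction_chiFour_alternating hx).tsum_eq
  have h3 := tendsto_nhds_unique hL h2
  rw [hval, Complex.ofReal_one] at h3
  rw [h3]
  push_cast
  rfl

-- With B(t) = t e^(t/4)/(e^t - 1), one has B(4ix) - B(-4ix) = -2ix sec x, because e^(4ix) - 1 =
-- e^(2ix) · 2i sin 2x and sin 2x = 2 sin x cos x. The difference retains the odd coefficients,
-- which are the Bernoulli polynomials at 1/4. In the proof `E a` is the series of e^(iax).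
open PowerSeries in
lemma eulerNumber_eq_bernoulli (k : ℕ) :
    (eulerNumber (2 * k) : ℂ) / ((2 * k).factorial : ℂ) = (-1) ^ (k + 1) * 4 ^ (2 * k + 1) *
      (((Polynomial.bernoulli (2 * k + 1)).map (algebraMap ℚ ℂ)).eval (1 / 4 : ℂ) /
        ((2 * k + 1).factorial : ℂ)) := by
  set B : ℂ⟦X⟧ := PowerSeries.mk fun n =>
    Polynomial.aeval (1 / 4 : ℂ) ((1 / n.factorial : ℚ) • Polynomial.bernoulli n) with hB
  have hgen : B * (PowerSeries.exp ℂ - 1) = X * rescale (1 / 4 : ℂ) (PowerSeries.exp ℂ) :=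
    Polynomial.bernoulli_generating_function (1 / 4 : ℂ)
  let E : ℂ → ℂ⟦X⟧ := fun a => rescale (a * I) (PowerSeries.exp ℂ)
  have hE : ∀ a b, E a * E b = E (a + b) := fun a b => by
    simp only [E]
    rw [exp_mul_exp_eq_exp_add, add_mul]
  have hE0 : E 0 = 1 := by
    simp only [E]
    ext n
    rcases n with _ | n <;> simp
  have hres : ∀ c : ℂ, rescale c X = PowerSeries.C c * (X : ℂ⟦X⟧) := fun c => by
    ext n
    simp only [coeff_rescale, coeff_C_mul, coeff_X]
    split_ifs with h
    · rw [h, pow_one]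
    · simp
  have h1 : rescale (4 * I) B * (E 4 - 1) = PowerSeries.C (4 * I) * X * E 1 := by
    have := congrArg (rescale (4 * I)) hgen
    simp only [map_mul, map_sub, map_one, hres, rescale_rescale] at this
    simpa [E] using this
  have h2 : rescale (-4 * I) B * (E (-4) - 1) = PowerSeries.C (-4 * I) * X * E (-1) := by
    have := congrArg (rescale (-4 * I)) hgen
    simp only [map_mul, map_sub, map_one, hres, rescale_rescale] at this
    simpa [E] using this
  have hcos : E 1 + E (-1) = 2 * PowerSeries.cos ℂ := by
    ext n
    rw [← map_ofNat (PowerSeries.C (R := ℂ)), coeff_C_mul, map_add, PowerSeries.cos, coeff_mk]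
    simp only [E, coeff_rescale, coeff_exp]
    rcases Nat.even_or_odd' n with ⟨m, rfl | rfl⟩
    · rw [if_pos (even_two_mul m), mul_pow, mul_pow, one_pow, pow_mul (-1 : ℂ), neg_one_sq, one_pow,
        pow_mul I, I_sq, Nat.mul_div_cancel_left m two_pos]
      simp
      ring
    · rw [if_neg (by simp), mul_pow, mul_pow, one_pow, pow_succ (-1 : ℂ), pow_mul (-1 : ℂ),
        neg_one_sq, one_pow]
      ring
  have hne : E 1 - E (-1) ≠ 0 := by
    intro h
    have := congrArg (PowerSeries.coeff 1) h
    simp [E, coeff_rescale] at this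
  have hmain : (rescale (4 * I) B - rescale (-4 * I) B) * PowerSeries.cos ℂ =
      PowerSeries.C (-2 * I) * X := by
    have e1 : E 1 * E (-1) = 1 := by rw [hE, add_neg_cancel, hE0]
    have e4 : E 4 = E 1 ^ 4 := by
      simp only [pow_succ, pow_zero, one_mul, hE]
      norm_num
    have e5 : E (-4) = E (-1) ^ 4 := by
      simp only [pow_succ, pow_zero, one_mul, hE]
      norm_num
    have n1 : E 1 ≠ 0 := left_ne_zero_of_mul_eq_one e1
    have c1 : PowerSeries.C (-4 * I) = -PowerSeries.C (4 * I) := by rw [← map_neg, neg_mul]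
    have c2 : 2 * PowerSeries.C (-2 * I) = -PowerSeries.C (4 * I) := by
      rw [← map_ofNat (PowerSeries.C (R := ℂ)), ← map_mul, ← map_neg]
      congr 1
      ring
    rw [e4] at h1
    rw [e5, c1] at h2
    have h20 : (2 : ℂ⟦X⟧) ≠ 0 := fun h => by
      have := congrArg (PowerSeries.constantCoeff (R := ℂ)) h
      rw [map_ofNat, map_zero] at this
      exact two_ne_zero this
    -- The cancelled factor 2 e²(e - e') is nonzero in the domain of power series; together with e +
    -- e' = 2 cos it makes up e⁴ - 1.
    refine mul_left_cancel₀ (mul_ne_zero (mul_ne_zero h20 (pow_ne_zero 2 n1)) hne) ?_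
    generalize E 1 = e at *
    generalize E (-1) = e' at *
    generalize rescale (4 * I) B = B₁ at *
    generalize rescale (-4 * I) B = B₂ at *
    generalize PowerSeries.C (4 * I) = J at *
    generalize PowerSeries.cos ℂ = co at *
    have f1 : e ^ 4 * e' ^ 4 = 1 := by rw [← mul_pow, e1, one_pow]
    have f2 : e ^ 2 * e' ^ 2 = 1 := by rw [← mul_pow, e1, one_pow]
    have f3 : e ^ 4 * e' = e ^ 3 := by linear_combination e ^ 3 * e1
    have f4 : e ^ 2 * e' = e := by linear_combination e * e1
    linear_combination -(B₁ - B₂) * e ^ 2 * (e - e') * hcos + h1 + e ^ 4 * h2 -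
      (B₁ - B₂) * f2 - B₂ * f1 - J * X * f3 - J * X * f4 - e ^ 2 * (e - e') * X * c2
  have hinv : (rescale (4 * I) B - rescale (-4 * I) B) =
      PowerSeries.C (-2 * I) * (PowerSeries.map (algebraMap ℚ ℂ) (PowerSeries.cos ℚ)⁻¹ * X) := by
    have h3 : PowerSeries.map (algebraMap ℚ ℂ) (PowerSeries.cos ℚ)⁻¹ * PowerSeries.cos ℂ = 1 := by
      rw [← PowerSeries.map_cos (algebraMap ℚ ℂ), ← map_mul, PowerSeries.inv_mul_cancel _
        (by simp [PowerSeries.cos]), map_one]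
    calc _ = (rescale (4 * I) B - rescale (-4 * I) B) * PowerSeries.cos ℂ *
          PowerSeries.map (algebraMap ℚ ℂ) (PowerSeries.cos ℚ)⁻¹ := by
            rw [mul_assoc, mul_comm (PowerSeries.cos ℂ), h3, mul_one]
      _ = _ := by
            rw [hmain]
            ring
  have hcoeff := congrArg (PowerSeries.coeff (2 * k + 1)) hinv
  rw [map_sub, coeff_rescale, coeff_rescale, coeff_C_mul, coeff_succ_mul_X, coeff_map] at hcoeff
  have hb : PowerSeries.coeff (2 * k + 1) B =
      ((Polynomial.bernoulli (2 * k + 1)).map (algebraMap ℚ ℂ)).eval (1 / 4 : ℂ) /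
        ((2 * k + 1).factorial : ℂ) := by
    rw [hB, coeff_mk, map_smul, Polynomial.eval_map_algebraMap, Algebra.smul_def]
    simp
    ring
  have he : (eulerNumber (2 * k) : ℂ) / ((2 * k).factorial : ℂ) =
      algebraMap ℚ ℂ (PowerSeries.coeff (2 * k) (PowerSeries.cos ℚ)⁻¹) := by
    have : ((2 * k).factorial : ℂ) ≠ 0 := by exact_mod_cast Nat.factorial_ne_zero _
    rw [eulerNumber]
    push_cast
    field_simp
    rfl
  have hI : (4 * I) ^ (2 * k + 1) = 4 ^ (2 * k + 1) * (-1) ^ k * I := by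
    rw [mul_pow, pow_succ I, pow_mul I, I_sq]
    ring
  have hI2 : (-4 * I) ^ (2 * k + 1) = -(4 * I) ^ (2 * k + 1) := by
    rw [neg_mul, Odd.neg_pow ⟨k, rfl⟩]
  rw [← hb, he]
  rw [hI2, hI] at hcoeff
  refine mul_left_cancel₀ (mul_ne_zero two_ne_zero I_ne_zero) ?_
  rw [pow_succ (-1 : ℂ)]
  linear_combination hcoeff

lemma LFunction_chiFour_odd (k : ℕ) : DirichletCharacter.LFunction chiFour (2 * k + 1) =
    (eulerNumber (2 * k) : ℂ) * (π : ℂ) ^ (2 * k + 1) /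
      (2 ^ (2 * k + 2) * ((2 * k).factorial : ℂ)) := by
  rcases eq_or_ne k 0 with rfl | hk
  · have h0 : eulerNumber 0 = 1 := by
      simp [eulerNumber, PowerSeries.cos]
    simp only [Nat.cast_zero, mul_zero, zero_add, LFunction_chiFour_one, h0]
    norm_num
  · have hre : 1 < (2 * (k : ℂ) + 1).re := by
      have : (0 : ℝ) < k := by exact_mod_cast Nat.pos_of_ne_zero hk
      simpa using this
    have h1 := HurwitzZeta.sinZeta_two_mul_nat_add_one (x := 1 / 4) hk (by norm_num)
    have h2 := eulerNumber_eq_bernoulli k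
    rw [← LFunction_chiFour_eq_sinZeta hre] at h1
    push_cast at h1
    have h3 : (eulerNumber (2 * k) : ℂ) * (π : ℂ) ^ (2 * k + 1) /
        (2 ^ (2 * k + 2) * ((2 * k).factorial : ℂ)) =
        (eulerNumber (2 * k) : ℂ) / ((2 * k).factorial : ℂ) * (π ^ (2 * k + 1) / 2 ^ (2 * k + 2)) :=
      by ring
    rw [h1, h3, h2, mul_pow, show (4 : ℂ) = 2 * 2 by norm_num, mul_pow, pow_succ (2 : ℂ) (2 * k + 1)]
    field_simp

/-! ### Summation over coprime pairs -/

/-- The summand `w^{-m} |w|^{-2s}` of Hecke's series. -/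
def heckeTerm (m : ℕ) (s w : ℂ) : ℂ := (w ^ m)⁻¹ * ((‖w‖ : ℝ) : ℂ) ^ (-2 * s)

lemma norm_heckeTerm (m : ℕ) (s : ℂ) {w : ℂ} (hw : w ≠ 0) :
    ‖heckeTerm m s w‖ = ‖w‖ ^ (-(m + 2 * s.re)) := by
  have h := norm_pos_iff.mpr hw
  rw [heckeTerm, norm_mul, norm_inv, norm_pow, Complex.norm_cpow_eq_rpow_re_of_pos h, neg_add,
    Real.rpow_add h, Real.rpow_neg h.le, Real.rpow_natCast]
  simp

lemma heckeTerm_ne_zero (m : ℕ) (s : ℂ) {w : ℂ} (hw : w ≠ 0) : heckeTerm m s w ≠ 0 := by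
  rw [← norm_pos_iff, norm_heckeTerm m s hw]
  exact Real.rpow_pos_of_pos (norm_pos_iff.mpr hw) _

lemma summable_heckeTerm (τ : ℍ) {m : ℕ} {s : ℂ} (h : 2 < m + 2 * s.re) :
    Summable fun p => poleSign p * heckeTerm m s (polePoint τ p) := by
  refine (summable_norm_polePoint_rpow τ h).of_norm_bounded fun p => ?_
  rw [norm_mul, norm_poleSign, one_mul, norm_heckeTerm _ _ (polePoint_ne_zero τ p)]

/-- Multiplicativity lets both the gcd N and the factor τ of the slash action be pulled out of the
sum. -/
lemma heckeTerm_mul (m : ℕ) (s x w : ℂ) :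
    heckeTerm m s (x * w) = heckeTerm m s x * heckeTerm m s w := by
  rw [heckeTerm, heckeTerm, heckeTerm, norm_mul, Complex.ofReal_mul,
    Complex.mul_cpow_ofReal_nonneg (norm_nonneg _) (norm_nonneg _), mul_pow, mul_inv]
  ring

lemma heckeTerm_natCast (m : ℕ) (s : ℂ) {n : ℕ} (hn : n ≠ 0) :
    heckeTerm m s n = ((n : ℂ) ^ (m + 2 * s))⁻¹ := by
  have hn' : (n : ℂ) ≠ 0 := Nat.cast_ne_zero.mpr hn
  rw [heckeTerm, Complex.norm_natCast, Complex.ofReal_natCast, Complex.cpow_add _ _ hn',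
    Complex.cpow_natCast, mul_inv, ← Complex.cpow_neg]
  ring_nf

/-- The index `(m, n)` of the pole `N ((c + d) τ - c)`, where `N = 2j + 1`. -/
def poleIndex (x : ℕ × eisIndex) : ℤ × ℤ :=
  (((2 * x.1 + 1) * (x.2.1.1 + x.2.1.2) - 1) / 2, -((2 * x.1 + 1) * x.2.1.1) / 2)

lemma two_mul_poleIndex (x : ℕ × eisIndex) :
    2 * (poleIndex x).1 + 1 = (2 * x.1 + 1) * (x.2.1.1 + x.2.1.2) ∧
      2 * (poleIndex x).2 = -((2 * x.1 + 1) * x.2.1.1) := by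
  obtain ⟨j, ⟨c, d⟩, ⟨c', hc⟩, ⟨d', hd⟩, h⟩ := x
  simp only at hc hd
  simp only [poleIndex]
  have e1 : (2 * (j : ℤ) + 1) * (c + d) = 2 * ((2 * j + 1) * (c' + d') + j) + 1 := by
    rw [hc, hd]; ring
  have e2 : (2 * (j : ℤ) + 1) * c = 2 * ((2 * j + 1) * c') := by rw [hc]; ring
  rw [e1, e2]
  constructor <;> omega

lemma polePoint_poleIndex (τ : ℍ) (x : ℕ × eisIndex) :
    polePoint τ (poleIndex x) = ((2 * x.1 + 1 : ℕ) : ℂ) *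
      ((x.2.1.1 + x.2.1.2) * τ - x.2.1.1) := by
  obtain ⟨h1, h2⟩ := two_mul_poleIndex x
  have h1' := congrArg (Int.cast : ℤ → ℂ) h1
  have h2' := congrArg (Int.cast : ℤ → ℂ) h2
  push_cast at h1' h2' ⊢
  rw [polePoint, h1', h2']
  ring

lemma poleSign_eq (p : ℤ × ℤ) :
    poleSign p = (ZMod.χ₄ ((2 * p.1 + 1 + 2 * p.2 : ℤ) : ZMod 4) : ℂ) := by
  rw [poleSign, ZMod.χ₄_int_eq_if_mod_four]
  rcases Int.even_or_odd (p.1 + p.2) with h | h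
  · rw [h.neg_one_zpow, if_neg, if_pos]
    · simp
    all_goals obtain ⟨k, hk⟩ := h; omega
  · rw [h.neg_one_zpow, if_neg, if_neg]
    · simp
    all_goals obtain ⟨k, hk⟩ := h; omega

lemma poleSign_poleIndex (x : ℕ × eisIndex) :
    poleSign (poleIndex x) = (ZMod.χ₄ ((2 * x.1 + 1 : ℕ) : ZMod 4) : ℂ) *
      (ZMod.χ₄ (x.2.1.2 : ZMod 4) : ℂ) := by
  obtain ⟨h1, h2⟩ := two_mul_poleIndex x
  rw [poleSign_eq, h1, h2, ← Int.cast_mul, ← map_mul]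
  congr 3
  push_cast
  ring

/-- The pair (-2n, 2m+1+2n) has an odd second entry, so its gcd N is odd and nonzero; dividing by it
gives a unique coprime pair (c,d) with c even and d odd. -/
lemma poleIndex_bijective : Function.Bijective poleIndex := by
  constructor
  · intro x y h
    obtain ⟨h1, h2⟩ := two_mul_poleIndex x
    obtain ⟨h3, h4⟩ := two_mul_poleIndex y
    rw [h] at h1 h2
    obtain ⟨j, ⟨c, d⟩, hc, hd, hx⟩ := x
    obtain ⟨j', ⟨c', d'⟩, hc', hd', hy⟩ := y
    simp only at *
    have ec : (2 * (j : ℤ) + 1) * c = (2 * j' + 1) * c' := by linarith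
    have ed : (2 * (j : ℤ) + 1) * d = (2 * j' + 1) * d' := by linarith
    -- For coprime (c,d) the gcd of (Nc, Nd) is N, so N can be read off from the pole.
    have g1 : Int.gcd ((2 * (j : ℤ) + 1) * c) ((2 * (j : ℤ) + 1) * d) = 2 * j + 1 := by
      rw [Int.gcd_mul_left, Int.isCoprime_iff_gcd_eq_one.mp hx]
      omega
    have g2 : Int.gcd ((2 * (j' : ℤ) + 1) * c') ((2 * (j' : ℤ) + 1) * d') = 2 * j' + 1 := by
      rw [Int.gcd_mul_left, Int.isCoprime_iff_gcd_eq_one.mp hy]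
      omega
    rw [ec, ed, g2] at g1
    obtain rfl : j = j' := by omega
    have hj : (2 * (j : ℤ) + 1) ≠ 0 := by omega
    obtain rfl := mul_left_cancel₀ hj ec
    obtain rfl := mul_left_cancel₀ hj ed
    rfl
  · rintro ⟨m, n⟩
    set C : ℤ := -2 * n
    set D : ℤ := 2 * m + 1 + 2 * n
    have hD : Odd D := ⟨m + n, by ring⟩
    have hg : Int.gcd C D ≠ 0 := fun h => by
      rw [Int.gcd_eq_zero_iff] at h
      simp [h.2] at hD
    obtain ⟨c, hc⟩ := Int.gcd_dvd_left C D
    obtain ⟨d, hd⟩ := Int.gcd_dvd_right C D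
    have hcop : IsCoprime c d := by
      rw [Int.isCoprime_iff_gcd_eq_one]
      have h := Int.gcd_mul_left (Int.gcd C D) c d
      rw [← hc, ← hd, Int.natAbs_natCast] at h
      exact (mul_eq_left₀ hg).mp h.symm
    have hN : Odd ((Int.gcd C D : ℕ) : ℤ) ∧ Odd d := by rwa [hd, Int.odd_mul] at hD
    obtain ⟨j, hj⟩ : Odd (Int.gcd C D) := by exact_mod_cast hN.1
    have hce : Even c := by
      have : Even C := ⟨-n, by ring⟩
      rw [hc, Int.even_mul] at this
      exact this.resolve_left (Int.not_even_iff_odd.mpr hN.1)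
    refine ⟨(j, ⟨(c, d), hce, hN.2, hcop⟩), ?_⟩
    obtain ⟨h1, h2⟩ := two_mul_poleIndex (j, ⟨(c, d), hce, hN.2, hcop⟩)
    rw [hj] at hc hd
    push_cast at hc hd
    simp only [mul_add, ← hc, ← hd] at h1 h2
    rw [Prod.ext_iff]
    constructor
    · simp only [C, D] at h1 h2 ⊢
      linarith
    · simp only [C, D] at h1 h2 ⊢
      linarith

lemma hasSum_LFunction_chiFour_odd {s : ℂ} (hs : 1 < s.re) :
    HasSum (fun j : ℕ => (ZMod.χ₄ ((2 * j + 1 : ℕ) : ZMod 4) : ℂ) *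
      (((2 * j + 1 : ℕ) : ℂ) ^ s)⁻¹) (DirichletCharacter.LFunction chiFour s) := by
  have hinj : Function.Injective fun j : ℕ => 2 * j + 1 := fun a b h => by simpa using h
  refine (hinj.hasSum_iff fun n hn => ?_).mpr (hasSum_LFunction_chiFour hs)
  have : n % 2 = 0 := by
    by_contra h
    exact hn ⟨n / 2, by simp only; omega⟩
  rw [ZMod.χ₄_nat_eq_if_mod_four, if_pos this]
  simp

/-- Under the bijection (N,(c,d)) ↦ pole the summand is a product of a term in N and a term in
(c,d), so the absolutely convergent sum factors. -/
lemma LFunction_mul_tsum_heckeTerm (τ : ℍ) {m : ℕ} {s : ℂ} (h : 2 < m + 2 * s.re) :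
    DirichletCharacter.LFunction chiFour (m + 2 * s) *
      ∑' p : eisIndex, (ZMod.χ₄ (p.1.2 : ZMod 4) : ℂ) *
        heckeTerm m s ((p.1.1 + p.1.2) * τ - p.1.1) =
      ∑' p, poleSign p * heckeTerm m s (polePoint τ p) := by
  have hterm : ∀ x : ℕ × eisIndex,
      poleSign (poleIndex x) * heckeTerm m s (polePoint τ (poleIndex x)) =
      ((ZMod.χ₄ ((2 * x.1 + 1 : ℕ) : ZMod 4) : ℂ) * (((2 * x.1 + 1 : ℕ) : ℂ) ^ (m + 2 * s))⁻¹) *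
        ((ZMod.χ₄ (x.2.1.2 : ZMod 4) : ℂ) *
          heckeTerm m s ((x.2.1.1 + x.2.1.2) * τ - x.2.1.1)) := by
    intro x
    rw [poleSign_poleIndex, polePoint_poleIndex, heckeTerm_mul,
      heckeTerm_natCast m s (Nat.succ_ne_zero _)]
    ring
  have hsum := (Equiv.ofBijective _ poleIndex_bijective).hasSum_iff.mpr
    (summable_heckeTerm τ h).hasSum
  have hsum' := hsum.congr_fun (g := _) fun x => (hterm x).symm
  have hL := hasSum_LFunction_chiFour_odd (s := m + 2 * s) (by simp; linarith)
  have hE : Summable fun p : eisIndex => (ZMod.χ₄ (p.1.2 : ZMod 4) : ℂ) *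
      heckeTerm m s ((p.1.1 + p.1.2) * τ - p.1.1) := by
    have h0 := hsum'.summable.comp_injective (i := fun p : eisIndex => ((0 : ℕ), p))
      fun a b h => congrArg Prod.snd h
    refine h0.congr fun p => ?_
    simp
  exact hL.mul_eq hE.hasSum hsum'

lemma gammaZero_smul_coe (τ : ℍ) : ((gammaZero • τ : ℍ) : ℂ) = (τ - 1) / τ := by
  rw [UpperHalfPlane.specialLinearGroup_apply]
  simp [gammaZero, sub_eq_add_neg]

theorem LFunction_mul_heckeSum (τ : ℍ) {m : ℕ} {s : ℂ} (h : 2 < m + 2 * s.re) :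
    2 * DirichletCharacter.LFunction chiFour (m + 2 * s) * heckeSum m (gammaZero • τ) s =
      (heckeTerm m s τ)⁻¹ * ∑' p, poleSign p * heckeTerm m s (polePoint τ p) := by
  have hτ := τ.ne_zero
  rw [← LFunction_mul_tsum_heckeTerm τ h, heckeSum]
  have e : ∀ p : eisIndex, (ZMod.χ₄ (p.1.2 : ZMod 4) : ℂ) *
      (((p.1.1 : ℂ) * (gammaZero • τ : ℍ) + p.1.2) ^ m)⁻¹ *
        ((‖(p.1.1 : ℂ) * (gammaZero • τ : ℍ) + p.1.2‖ : ℝ) : ℂ) ^ (-2 * s) =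
      (heckeTerm m s τ)⁻¹ * ((ZMod.χ₄ (p.1.2 : ZMod 4) : ℂ) *
        heckeTerm m s ((p.1.1 + p.1.2) * τ - p.1.1)) := by
    intro p
    -- The action of γ₀ turns cz + d into ((c+d)τ - c)/τ.
    have h1 : ((p.1.1 + p.1.2) * τ - p.1.1 : ℂ) =
        τ * ((p.1.1 : ℂ) * (gammaZero • τ : ℍ) + p.1.2) := by
      rw [gammaZero_smul_coe]
      field_simp
      ring
    have h2 := heckeTerm_ne_zero m s hτ
    rw [h1, heckeTerm_mul, mul_assoc]
    change _ * heckeTerm m s _ = _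
    field_simp
  rw [tsum_congr e, tsum_mul_left]
  ring

/-! ### Hecke's summation in weight one -/

/-- The mean value inequality applied twice: to F' on an interval of length 2, then to t ↦ F(t) -
F(t-2) on [0,2]. -/
lemma norm_second_difference_le {F F' F'' : ℝ → ℂ} {C : ℝ} (h1 : ∀ t, HasDerivAt F (F' t) t)
    (h2 : ∀ t, HasDerivAt F' (F'' t) t) (hC : ∀ t ∈ Set.Icc (-2 : ℝ) 2, ‖F'' t‖ ≤ C) :
    ‖2 * F 0 - F (-2) - F 2‖ ≤ 4 * C := by
  have hF' : ∀ t ∈ Set.Icc (0 : ℝ) 2, ‖F' t - F' (t - 2)‖ ≤ C * 2 := by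
    intro t ht
    have := (convex_Icc (-2 : ℝ) 2).norm_image_sub_le_of_norm_hasDerivWithin_le
      (fun x _ => (h2 x).hasDerivWithinAt) hC (x := t - 2) (y := t)
      ⟨by linarith [ht.1], by linarith [ht.2]⟩ ⟨by linarith [ht.1], ht.2⟩
    simpa using this
  have hG : ∀ t, HasDerivAt (fun t => F t - F (t - 2)) (F' t - F' (t - 2)) t := fun t =>
    (h1 t).sub ((h1 (t - 2)).comp_sub_const t 2)
  have := (convex_Icc (0 : ℝ) 2).norm_image_sub_le_of_norm_hasDerivWithin_le
    (fun x _ => (hG x).hasDerivWithinAt) hF' (x := 0) (y := 2) (by simp) (by simp)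
  rw [← norm_neg]
  calc ‖-(2 * F 0 - F (-2) - F 2)‖ = ‖F 2 - F (2 - 2) - (F 0 - F (0 - 2))‖ := by
        congr 1
        norm_num
        ring
    _ ≤ C * 2 * ‖(2 : ℝ) - 0‖ := this
    _ = 4 * C := by norm_num; ring

/-- Along w + t with t real, w w̄ becomes a polynomial in t, so this form can be differentiated by
the chain rule. -/
lemma heckeTerm_eq_cpow (m : ℕ) (s w : ℂ) :
    heckeTerm m s w = (w ^ m)⁻¹ * (w * (starRingEnd ℂ) w) ^ (-s) := by
  rcases eq_or_ne w 0 with rfl | hw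
  · rcases eq_or_ne s 0 with rfl | hs
    · simp [heckeTerm]
    · simp [heckeTerm, hs]
  have hn : ((‖w‖ : ℝ) : ℂ) ≠ 0 := by simpa using hw
  rw [heckeTerm, Complex.mul_conj, Complex.normSq_eq_norm_sq, sq, Complex.ofReal_mul,
    Complex.mul_cpow_ofReal_nonneg (norm_nonneg _) (norm_nonneg _), ← Complex.cpow_add _ _ hn]
  ring_nf

/-- The logarithmic derivative of `t ↦ (w + t)⁻¹ |w + t|^{-2s}`. -/
def heckeLogDeriv (s w : ℂ) : ℂ := -((1 + s) * w⁻¹ + s * ((starRingEnd ℂ) w)⁻¹)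

lemma hasDerivAt_inv_add {w : ℂ} {t : ℝ} (h : w + t ≠ 0) :
    HasDerivAt (fun t : ℝ => (w + t)⁻¹) (-((w + t)⁻¹) ^ 2) t := by
  have h1 := (((hasDerivAt_id (t : ℂ)).const_add w).inv h).comp_ofReal
  convert! h1 using 1
  simp [neg_div]

lemma hasDerivAt_heckeTerm {w : ℂ} (s : ℂ) {t : ℝ} (h : w + t ≠ 0) :
    HasDerivAt (fun t : ℝ => heckeTerm 1 s (w + t))
      (heckeTerm 1 s (w + t) * heckeLogDeriv s (w + t)) t := by
  have hc : (starRingEnd ℂ) w + t ≠ 0 := fun h' =>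
    h (by simpa using congrArg (starRingEnd ℂ) h')
  have h1 : HasDerivAt (fun t : ℂ => (w + t) * ((starRingEnd ℂ) w + t))
      (1 * ((starRingEnd ℂ) w + t) + (w + t) * 1) t :=
    ((hasDerivAt_id (t : ℂ)).const_add w).mul ((hasDerivAt_id (t : ℂ)).const_add _)
  have hs : (w + t) * ((starRingEnd ℂ) w + t) ∈ slitPlane := by
    have e : (starRingEnd ℂ) w + t = (starRingEnd ℂ) (w + t) := by simp
    rw [e, Complex.mul_conj, Complex.ofReal_mem_slitPlane]
    exact Complex.normSq_pos.mpr h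
  have h2 := (hasDerivAt_inv_add h).mul (h1.cpow_const (c := -s) hs).comp_ofReal
  convert! h2 using 1
  · funext t
    rw [heckeTerm_eq_cpow]
    simp
  · rw [heckeTerm_eq_cpow, heckeLogDeriv, Complex.cpow_sub _ _ (mul_ne_zero h hc), Complex.cpow_one]
    simp only [map_add, Complex.conj_ofReal]
    field_simp
    ring

lemma hasDerivAt_heckeLogDeriv {w : ℂ} (s : ℂ) {t : ℝ} (h : w + t ≠ 0) :
    HasDerivAt (fun t : ℝ => heckeLogDeriv s (w + t))
      ((1 + s) * ((w + t)⁻¹) ^ 2 + s * (((starRingEnd ℂ) (w + t))⁻¹) ^ 2) t := by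
  have hc : (starRingEnd ℂ) w + t ≠ 0 := fun h' =>
    h (by simpa using congrArg (starRingEnd ℂ) h')
  have h1 := (((hasDerivAt_inv_add h).const_mul (1 + s)).add
    ((hasDerivAt_inv_add hc).const_mul s)).neg
  convert! h1 using 1
  · funext t
    simp [heckeLogDeriv]
  · simp only [map_add, Complex.conj_ofReal]
    ring

/-- If L is the logarithmic derivative of F, then F'' = F(L² + L'). Both L² and L' are at most (1 +
2‖s‖)²/‖w + t‖² in norm, so the second difference gains two powers. -/
lemma norm_negSecondDiff_heckeTerm_le (s : ℂ) {w : ℂ} (hw : ∀ t : ℝ, w + t ≠ 0) {B : ℝ}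
    (hB : ∀ t ∈ Set.Icc (-2 : ℝ) 2, ‖w + t‖ ^ (-(3 + 2 * s.re)) ≤ B) :
    ‖negSecondDiff (heckeTerm 1 s) w‖ ≤ 2 * (1 + 2 * ‖s‖) ^ 2 * B := by
  have h1 := fun t => hasDerivAt_heckeTerm s (hw t)
  have h2 := fun t => (h1 t).mul (hasDerivAt_heckeLogDeriv s (hw t))
  have h3 := norm_second_difference_le (C := 2 * (1 + 2 * ‖s‖) ^ 2 * B) h1 h2 fun t ht => by
    refine le_trans ?_ (mul_le_mul_of_nonneg_left (hB t ht) (by positivity))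
    have hn := norm_pos_iff.mpr (hw t)
    have hr : ‖w + t‖ ^ (-(3 + 2 * s.re)) = ‖heckeTerm 1 s (w + t)‖ * (‖w + t‖⁻¹) ^ 2 := by
      rw [norm_heckeTerm _ _ (hw t), ← Real.rpow_natCast, Real.inv_rpow hn.le, ← Real.rpow_neg hn.le,
        ← Real.rpow_add hn]
      congr 1
      push_cast
      ring
    have hq : ‖heckeLogDeriv s (w + t)‖ ≤ (1 + 2 * ‖s‖) * ‖w + t‖⁻¹ := by
      rw [heckeLogDeriv, norm_neg]
      refine (norm_add_le _ _).trans ?_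
      rw [norm_mul, norm_mul, norm_inv, norm_inv, Complex.norm_conj]
      have := norm_add_le 1 s
      rw [norm_one] at this
      nlinarith [inv_pos.mpr hn]
    have hq' : ‖(1 + s) * ((w + t)⁻¹) ^ 2 + s * (((starRingEnd ℂ) (w + t))⁻¹) ^ 2‖ ≤
        (1 + 2 * ‖s‖) * (‖w + t‖⁻¹) ^ 2 := by
      refine (norm_add_le _ _).trans ?_
      rw [norm_mul, norm_mul, norm_pow, norm_pow, norm_inv, norm_inv, Complex.norm_conj]
      have := norm_add_le 1 s
      rw [norm_one] at this
      nlinarith [pow_pos (inv_pos.mpr hn) 2]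
    rw [hr, mul_assoc, ← mul_add, norm_mul, mul_left_comm]
    refine mul_le_mul_of_nonneg_left ((norm_add_le _ _).trans ?_) (norm_nonneg _)
    rw [norm_mul]
    have h4 := mul_le_mul hq hq (norm_nonneg _) (by positivity)
    have h5 : (1 + 2 * ‖s‖) * (‖w + t‖⁻¹) ^ 2 ≤ (1 + 2 * ‖s‖) ^ 2 * (‖w + t‖⁻¹) ^ 2 := by
      gcongr
      nlinarith [norm_nonneg s]
    calc _ ≤ (1 + 2 * ‖s‖) * ‖w + t‖⁻¹ * ((1 + 2 * ‖s‖) * ‖w + t‖⁻¹) +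
          (1 + 2 * ‖s‖) ^ 2 * (‖w + t‖⁻¹) ^ 2 := add_le_add h4 (hq'.trans h5)
      _ = _ := by ring
  have h4 : negSecondDiff (heckeTerm 1 s) w = (2 * heckeTerm 1 s (w + (0 : ℝ)) -
      heckeTerm 1 s (w + (-2 : ℝ)) - heckeTerm 1 s (w + (2 : ℝ))) / 4 := by
    simp [negSecondDiff, sub_eq_add_neg]
  rw [h4, norm_div, show ‖(4 : ℂ)‖ = 4 by norm_num, div_le_iff₀ (by norm_num), mul_comm _ 4]
  exact h3

lemma polePoint_add_ofReal_ne_zero (τ : ℍ) (p : ℤ × ℤ) (t : ℝ) : polePoint τ p + t ≠ 0 := by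
  intro h
  refine ofReal_ne_polePoint τ (-t) p ?_
  rw [Complex.ofReal_neg]
  exact (eq_neg_of_add_eq_zero_left h).symm

lemma mul_norm_polePoint_le (τ : ℍ) (p : ℤ × ℤ) {t : ℝ} (ht : t ∈ Set.Icc (-2 : ℝ) 2) :
    τ.im ≤ ‖polePoint τ p + t‖ ∧
      min (1 / 2) (τ.im / 4) * ‖polePoint τ p‖ ≤ ‖polePoint τ p + t‖ := by
  have h1 : τ.im ≤ ‖polePoint τ p + t‖ := by
    refine (im_le_abs_im_polePoint τ p).trans ?_
    simpa using Complex.abs_im_le_norm (polePoint τ p + t)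
  refine ⟨h1, ?_⟩
  -- Far out, a shift by at most 2 costs at most half of the norm; for norm at most 4 the lower
  -- bound Im τ suffices.
  rcases le_total 4 ‖polePoint τ p‖ with h | h
  · have h2 : ‖polePoint τ p‖ ≤ ‖polePoint τ p + t‖ + ‖(t : ℂ)‖ := by
      simpa using norm_sub_le (polePoint τ p + t) t
    have h3 : ‖(t : ℂ)‖ ≤ 2 := by
      rw [Complex.norm_real, Real.norm_eq_abs]
      exact abs_le.mpr ht
    have := mul_le_mul_of_nonneg_right (min_le_left (1 / 2) (τ.im / 4))
      (norm_nonneg (polePoint τ p))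
    linarith
  · have := mul_le_mul_of_nonneg_right (min_le_right (1 / 2) (τ.im / 4))
      (norm_nonneg (polePoint τ p))
    nlinarith [τ.im_pos]

/-- For Re s > -1/4 the exponent 3 + 2 Re s exceeds 5/2 > 2. The terms are thus dominated, uniformly
for bounded s, by a convergent series on a region that contains s = 0 in its interior. -/
lemma exists_norm_negSecondDiff_heckeTerm_le (τ : ℍ) (A : ℝ) : ∃ C : ℝ, ∀ s : ℂ,
    -1 / 4 < s.re → ‖s‖ < A → ∀ p, ‖negSecondDiff (heckeTerm 1 s) (polePoint τ p)‖ ≤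
      C * ‖polePoint τ p‖ ^ (-(5 / 2) : ℝ) := by
  have hρ := τ.im_pos
  set c := min (1 / 2) (τ.im / 4)
  have hc : 0 < c := lt_min (by norm_num) (by linarith)
  refine ⟨2 * (1 + 2 * A) ^ 2 * ((1 + τ.im⁻¹) ^ (1 / 2 + 2 * A) * c ^ (-(5 / 2) : ℝ)),
    fun s hs hA p => ?_⟩
  have hp := norm_pos_iff.mpr (polePoint_ne_zero τ p)
  have h0 : s.re ≤ A := (Complex.re_le_norm s).trans hA.le
  have hb := norm_negSecondDiff_heckeTerm_le s (polePoint_add_ofReal_ne_zero τ p)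
    (B := (1 + τ.im⁻¹) ^ (1 / 2 + 2 * A) * (c * ‖polePoint τ p‖) ^ (-(5 / 2) : ℝ)) fun t ht => by
      obtain ⟨h1, h2⟩ := mul_norm_polePoint_le τ p ht
      have hn : 0 < ‖polePoint τ p + t‖ := hρ.trans_le h1
      have e : -(3 + 2 * s.re) = -(1 / 2 + 2 * s.re) + -(5 / 2) := by ring
      rw [e, Real.rpow_add hn]
      refine mul_le_mul ?_ ?_ (Real.rpow_nonneg hn.le _) (by positivity)
      · calc ‖polePoint τ p + t‖ ^ (-(1 / 2 + 2 * s.re))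
            ≤ τ.im ^ (-(1 / 2 + 2 * s.re)) :=
              Real.rpow_le_rpow_of_nonpos hρ h1 (by linarith)
          _ = (τ.im⁻¹) ^ (1 / 2 + 2 * s.re) := by rw [Real.rpow_neg hρ.le, Real.inv_rpow hρ.le]
          _ ≤ (1 + τ.im⁻¹) ^ (1 / 2 + 2 * s.re) :=
              Real.rpow_le_rpow (by positivity) (by linarith) (by linarith)
          _ ≤ (1 + τ.im⁻¹) ^ (1 / 2 + 2 * A) :=
              Real.rpow_le_rpow_of_exponent_le (by linarith [inv_pos.mpr hρ]) (by linarith)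
      · exact Real.rpow_le_rpow_of_nonpos (by positivity) h2 (by norm_num)
  refine hb.trans ?_
  rw [Real.mul_rpow hc.le hp.le]
  calc _ ≤ 2 * (1 + 2 * A) ^ 2 * ((1 + τ.im⁻¹) ^ (1 / 2 + 2 * A) *
        (c ^ (-(5 / 2) : ℝ) * ‖polePoint τ p‖ ^ (-(5 / 2) : ℝ))) := by gcongr
    _ = _ := by ring

/-- Hecke's series in weight one over all lattice points, regularized. -/
def heckeReg (τ : ℍ) (s : ℂ) : ℂ :=
  ∑' p, poleSign p * negSecondDiff (heckeTerm 1 s) (polePoint τ p)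

lemma differentiable_heckeTerm (m : ℕ) {w : ℂ} (hw : w ≠ 0) :
    Differentiable ℂ fun s => heckeTerm m s w := by
  have hn : ((‖w‖ : ℝ) : ℂ) ≠ 0 := by simpa using hw
  intro s
  exact ((((differentiableAt_id).const_mul (-2)).const_cpow (Or.inl hn))).const_mul _

lemma analyticAt_heckeReg (τ : ℍ) {s₀ : ℂ} (hs : 0 ≤ s₀.re) : AnalyticAt ℂ (heckeReg τ) s₀ := by
  obtain ⟨C, hC⟩ := exists_norm_negSecondDiff_heckeTerm_le τ (‖s₀‖ + 1)
  let U : Set ℂ := {s | -1 / 4 < s.re} ∩ Metric.ball 0 (‖s₀‖ + 1)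
  have hU : IsOpen U := (isOpen_lt continuous_const Complex.continuous_re).inter Metric.isOpen_ball
  have hsU : s₀ ∈ U := ⟨by simp only [Set.mem_ofPred_eq]; linarith, by simp⟩
  have hd : DifferentiableOn ℂ (heckeReg τ) U := by
    refine differentiableOn_tsum_of_summable_norm
      ((summable_norm_polePoint_rpow τ (k := 5 / 2) (by norm_num)).mul_left C) (fun p => ?_) hU
      fun p s h => ?_
    · have h0 := differentiable_heckeTerm 1 (polePoint_ne_zero τ p)
      have h1 := differentiable_heckeTerm 1 (polePoint_ne_zero τ (p + (0, -1)))
      have h2 := differentiable_heckeTerm 1 (polePoint_ne_zero τ (p + (0, 1)))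
      rw [← polePoint_sub_two] at h1
      rw [← polePoint_add_two] at h2
      exact (((((h0.const_mul 2).sub h1).sub h2).div_const 4).const_mul _).differentiableOn
    · rw [norm_mul, norm_poleSign, one_mul]
      exact hC s h.1 (mem_ball_zero_iff.mp h.2) p
  exact hd.analyticAt (hU.mem_nhds hsU)

lemma LFunction_chiFour_ne_zero {s : ℂ} (hs : 1 ≤ s.re) :
    DirichletCharacter.LFunction chiFour s ≠ 0 :=
  DirichletCharacter.LFunction_ne_zero_of_one_le_re _ (Or.inl chiFour_ne_one) hs

lemma heckeTerm_zero_right (m : ℕ) (w : ℂ) : heckeTerm m 0 w = (w ^ m)⁻¹ := by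
  simp [heckeTerm]

/-- For Re s > 1/2 the sum over the poles converges absolutely and may be regularized. The
regularized sum divided by 2L(1+2s,χ₄) continues it, as L has no zero on Re ≥ 1. -/
theorem isHeckeValue_heckeSum (τ : ℍ) : IsHeckeValue (heckeSum 1 (gammaZero • τ))
    (τ * oddPoleSum τ 0 / (2 * DirichletCharacter.LFunction chiFour 1)) := by
  refine ⟨fun s => (heckeTerm 1 s τ)⁻¹ * heckeReg τ s /
    (2 * DirichletCharacter.LFunction chiFour (1 + 2 * s)), fun s hs => ?_, fun s hs => ?_, ?_⟩
  · have h1 : AnalyticAt ℂ (fun s => heckeTerm 1 s τ) s :=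
      (differentiable_heckeTerm 1 τ.ne_zero).analyticAt s
    have h2 : AnalyticAt ℂ (fun s => DirichletCharacter.LFunction chiFour (1 + 2 * s)) s :=
      ((DirichletCharacter.differentiable_LFunction chiFour_ne_one).comp
        ((differentiable_id.const_mul 2).const_add 1)).analyticAt s
    refine ((h1.inv (heckeTerm_ne_zero 1 s τ.ne_zero)).mul (analyticAt_heckeReg τ hs)).div
      (analyticAt_const.mul h2) (mul_ne_zero two_ne_zero (LFunction_chiFour_ne_zero ?_))
    simpa using hs
  · have h : 2 < ((1 : ℕ) : ℝ) + 2 * s.re := by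
      push_cast
      linarith
    have h1 := LFunction_mul_heckeSum τ h
    rw [← tsum_negSecondDiff τ (summable_heckeTerm τ h)] at h1
    have h2 : DirichletCharacter.LFunction chiFour (1 + 2 * s) ≠ 0 := by
      refine LFunction_chiFour_ne_zero ?_
      simp
      linarith
    simp only
    rw [heckeReg, ← h1, Nat.cast_one, mul_div_cancel_left₀]
    exact mul_ne_zero two_ne_zero h2
  · have e : heckeReg τ 0 = oddPoleSum τ 0 := by
      simp only [heckeReg, oddPoleSum, negSecondDiff, heckeTerm_zero_right]
    simp [e, heckeTerm_zero_right]

lemma eisE_zero (τ : ℍ) : eisE 0 (gammaZero • τ) =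
    τ * oddPoleSum τ 0 / (2 * DirichletCharacter.LFunction chiFour 1) := by
  have h := isHeckeValue_heckeSum τ
  rw [eisE, if_pos rfl]
  -- The chosen value is a Hecke value because one exists, and Hecke values are unique.
  exact (Classical.epsilon_spec ⟨_, h⟩ : IsHeckeValue _ _).unique h

lemma eisE_of_ne_zero {k : ℕ} (hk : k ≠ 0) (z : ℍ) : eisE k z = heckeSum (2 * k + 1) z 0 := by
  rw [eisE, if_neg hk, heckeSum]
  simp

theorem LFunction_mul_eisE (τ : ℍ) (k : ℕ) :
    2 * DirichletCharacter.LFunction chiFour (2 * k + 1) * eisE k (gammaZero • τ) =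
      τ ^ (2 * k + 1) * oddPoleSum τ k := by
  rcases eq_or_ne k 0 with rfl | hk
  · have h2 : DirichletCharacter.LFunction chiFour 1 ≠ 0 := LFunction_chiFour_ne_zero (by simp)
    rw [eisE_zero]
    simp
    field_simp
  · have h : 2 < ((2 * k + 1 : ℕ) : ℝ) + 2 * (0 : ℂ).re := by
      have : 1 ≤ k := Nat.one_le_iff_ne_zero.mpr hk
      simp
      norm_cast
      lia
    have h1 := LFunction_mul_heckeSum τ h
    rw [← tsum_negSecondDiff τ (summable_heckeTerm τ h)] at h1
    simp only [heckeTerm_zero_right, negSecondDiff] at h1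
    rw [eisE_of_ne_zero hk, oddPoleSum]
    simp only [negSecondDiff]
    simpa using h1

/-- The slash factor τ^(-(2k+1)) cancels the power of τ in `LFunction_mul_eisE`, leaving the pole
sum that occurs in the expansion of cn. -/
theorem LFunction_mul_eisG (τ : ℍ) (k : ℕ) :
    2 * DirichletCharacter.LFunction chiFour (2 * k + 1) * eisG k τ = oddPoleSum τ k := by
  have hτ := τ.ne_zero
  have h := LFunction_mul_eisE τ k
  have hd : UpperHalfPlane.denom gammaZero τ = τ := by
    rw [ModularGroup.denom_apply]
    simp [gammaZero]
  rw [eisG, ModularForm.SL_slash_apply, hd, zpow_neg, zpow_natCast, ← mul_assoc, h]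
  field_simp

/-! ### The power series of `cn` -/

/-- An expansion in even powers valid near the origin is valid on each disc of analyticity. -/
lemma hasSum_even_of_analyticOnNhd {f : ℂ → ℂ} {a : ℕ → ℂ} {ρ r : ℝ} (hρ : 0 < ρ)
    (h : ∀ u, ‖u‖ < ρ → HasSum (fun k : ℕ => a k * u ^ (2 * k)) (f u))
    (hf : AnalyticOnNhd ℂ f (Metric.ball 0 r)) {u : ℂ} (hu : u ∈ Metric.ball (0 : ℂ) r) :
    HasSum (fun k : ℕ => a k * u ^ (2 * k)) (f u) := by
  let b : ℕ → ℂ := fun n => if Even n then a (n / 2) else 0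
  have hinj : Function.Injective fun k : ℕ => 2 * k := fun x y hxy => by simpa using hxy
  have hiff : ∀ x y : ℂ, HasSum (fun k : ℕ => a k * x ^ (2 * k)) y ↔
      HasSum (fun n => b n * x ^ n) y := fun x y => by
    rw [← hinj.hasSum_iff (f := fun n => b n * x ^ n)]
    · simp [b, Function.comp_def]
    · intro n hn
      have : ¬ Even n := fun ⟨m, hm⟩ => hn ⟨m, by simp only; omega⟩
      simp [b, this]
  have hb : HasFPowerSeriesAt f (FormalMultilinearSeries.ofScalars ℂ b) 0 := by
    rw [hasFPowerSeriesAt_iff]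
    filter_upwards [Metric.ball_mem_nhds (0 : ℂ) hρ] with x hx
    have := (hiff x (f x)).mp (h x (mem_ball_zero_iff.mp hx))
    simpa [FormalMultilinearSeries.coeff_ofScalars, mul_comm] using this
  have h0 : (0 : ℂ) ∈ Metric.ball (0 : ℂ) r := Metric.mem_ball_self (Metric.pos_of_mem_ball hu)
  -- The expansion near 0 determines the Taylor coefficients, and the Taylor series converges on any
  -- disc of analyticity.
  have heq := hb.eq_formalMultilinearSeries (hf 0 h0).hasFPowerSeriesAt
  have hcoeff : ∀ n, b n = iteratedDeriv n f 0 / n.factorial := fun n => by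
    simpa [FormalMultilinearSeries.coeff_ofScalars] using congrArg (fun p => p.coeff n) heq
  rw [hiff]
  convert! Complex.hasSum_taylorSeries_on_ball hf.differentiableOn hu using 2 with n
  rw [hcoeff, smul_eq_mul, smul_eq_mul, sub_zero]
  ring

lemma jacobiCn_analyticAt_zero (τ : ℍ) : AnalyticAt ℂ (jacobiCn τ) 0 := by
  have h0 : ∀ p, (0 : ℂ) / quarterPeriod τ ≠ polePoint τ p := fun p => by
    rw [zero_div]
    exact (polePoint_ne_zero τ p).symm
  have h : AnalyticAt ℂ (cnNormalized τ ∘ fun u => u / quarterPeriod τ) 0 :=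
    AnalyticAt.comp (f := fun u : ℂ => u / quarterPeriod τ) (cnNormalized_analyticAt τ h0)
      analyticAt_id.div_const
  exact h.congr (Filter.Eventually.of_forall fun u => (jacobiCn_eq τ u).symm)

theorem hasSum_jacobiCn (τ : ℍ) {u : ℂ} (hu : ‖u‖ < τ.im * ‖quarterPeriod τ‖) :
    HasSum (fun k : ℕ => I * (eulerNumber (2 * k) : ℂ) * (π : ℂ) ^ (2 * k + 1) /
        ((2 : ℂ) ^ (2 * k + 1) * ((2 * k).factorial : ℂ)) *
          (eisG k τ / (quarterPeriod τ ^ (2 * k + 1) * (Theta2 τ ^ 2 / Theta3 τ ^ 2))) *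
          u ^ (2 * k)) (jacobiCn τ u) := by
  have hK := quarterPeriod_ne_zero τ
  have hv : ‖u / quarterPeriod τ‖ < τ.im := by
    rwa [norm_div, div_lt_iff₀ (norm_pos_iff.mpr hK)]
  have h := hasSum_cnNormalized τ hv
  rw [← jacobiCn_eq] at h
  refine h.congr_fun fun k => ?_
  have h2 := Theta2_ne_zero τ
  have h3 := Theta3_ne_zero τ
  have hpi : (π : ℂ) ≠ 0 := by exact_mod_cast Real.pi_ne_zero
  -- Since Kκ = (π/2)Θ₂², minus the residue is exactly i/(Kκ).
  have e : quarterPeriod τ ^ (2 * k + 1) * (Theta2 τ ^ 2 / Theta3 τ ^ 2) =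
      quarterPeriod τ ^ (2 * k) * (π / 2 * Theta2 τ ^ 2) := by
    rw [pow_succ]
    nth_rewrite 2 [quarterPeriod]
    field_simp
  have hf : ((2 * k).factorial : ℂ) ≠ 0 := by exact_mod_cast (2 * k).factorial_ne_zero
  rw [← LFunction_mul_eisG, LFunction_chiFour_odd, e, cnResidue, div_pow]
  field_simp
  ring

end JacobiEisenstein

end

theorem proposition2p3 (z : UpperHalfPlane) (κ K : ℂ)
    (hκ : κ = JacobiEisenstein.Theta2 (JacobiEisenstein.twice z) ^ 2 /
      JacobiEisenstein.Theta3 (JacobiEisenstein.twice z) ^ 2)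
    (hK : K = π / 2 * JacobiEisenstein.Theta3 (JacobiEisenstein.twice z) ^ 2) :
    AnalyticAt ℂ (JacobiEisenstein.jacobiCn (JacobiEisenstein.twice z)) 0 ∧
    ∀ r : ℝ, AnalyticOnNhd ℂ (JacobiEisenstein.jacobiCn (JacobiEisenstein.twice z))
        (Metric.ball 0 r) →
      ∀ u ∈ Metric.ball (0 : ℂ) r,
        HasSum (fun k : ℕ =>
          Complex.I * (JacobiEisenstein.eulerNumber (2 * k) : ℂ) * (π : ℂ) ^ (2 * k + 1) /
              ((2 : ℂ) ^ (2 * k + 1) * ((2 * k).factorial : ℂ)) *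
            (JacobiEisenstein.eisG k (JacobiEisenstein.twice z) / (K ^ (2 * k + 1) * κ)) *
            u ^ (2 * k))
          (JacobiEisenstein.jacobiCn (JacobiEisenstein.twice z) u) := by
  have hK' : K = JacobiEisenstein.quarterPeriod (JacobiEisenstein.twice z) := hK
  subst hK' hκ
  refine ⟨JacobiEisenstein.jacobiCn_analyticAt_zero _, fun r hr u hu => ?_⟩
  have hρ := mul_pos (JacobiEisenstein.twice z).im_pos
    (norm_pos_iff.mpr (JacobiEisenstein.quarterPeriod_ne_zero (JacobiEisenstein.twice z)))
  exact JacobiEisenstein.hasSum_even_of_analyticOnNhd hρ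
    (fun v hv => JacobiEisenstein.hasSum_jacobiCn _ hv) hr hu
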